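/- Let $k$ be an algebraically closed field, $S=k[x_1,\dots,x_n]$ a standard graded polynomial ring, and $I=I_1+I_2$, where $I_1,I_2\subseteq S$ are ideals of height one, each generated by quadrics (homogeneous polynomials of degree $2$), which are transversal, i.e. $I_1\cap I_2=I_1I_2$. An ideal $J$ in a standard graded polynomial ring $T$ over $k$ (or the algebra $T/J$) is called G-quadratic if, after a linear change of coordinates, it has a Gröbner basis consisting of quadrics for some monomial order. Then $S/I$ is LG-quadratic: there are a G-quadratic algebra $A=k[y_1,\dots,y_m]/J$ and an $A$-regular sequence $\ell_1,\dots,\ell_c$ of linear forms with $S/I\cong A/(\ell_1,\dots,\ell_c)$ as graded $k$-algebras. Moreover, if neither $I_1$ nor $I_2$ is a principal ideal generated by an irreducible quadric, then $J$ can be chosen to be generated by monomials of degree $2$. -/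

import Mathlib

namespace LGQuadratic

/-- The ideal `I` is generated by quadrics, i.e. by homogeneous polynomials of degree two. -/
def GeneratedByQuadrics {k : Type*} [Field k] {n : ℕ}
    (I : Ideal (MvPolynomial (Fin n) k)) : Prop :=
  ∃ Q : Set (MvPolynomial (Fin n) k), (∀ q ∈ Q, q.IsHomogeneous 2) ∧ I = Ideal.span Q

/-- The ideal `I` is generated by monomials of degree two. -/
def GeneratedByQuadraticMonomials {k : Type*} [Field k] {n : ℕ}
    (I : Ideal (MvPolynomial (Fin n) k)) : Prop :=
  ∃ E : Set (Fin n →₀ ℕ), (∀ e ∈ E, e.degree = 2) ∧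
    I = Ideal.span ((fun e => MvPolynomial.monomial e (1 : k)) '' E)

/-- Two ideals are transversal if their intersection equals their product. -/
def Transversal {R : Type*} [CommRing R] (I₁ I₂ : Ideal R) : Prop :=
  I₁ ⊓ I₂ = I₁ * I₂

/-- `G` is a Gröbner basis of `I` for the monomial order `ord`: it is a finite set of nonzero
elements of `I` whose leading terms generate the initial ideal of `I`. -/
structure IsGroebnerBasis {k : Type*} [Field k] {n : ℕ} (ord : MonomialOrder.{0, 0} (Fin n))
    (G : Finset (MvPolynomial (Fin n) k)) (I : Ideal (MvPolynomial (Fin n) k)) : Prop where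
  ne_zero : ∀ g ∈ G, g ≠ 0
  subset : ∀ g ∈ G, g ∈ I
  span_leadingTerm : Ideal.span (ord.leadingTerm '' (G : Set (MvPolynomial (Fin n) k))) =
    Ideal.span (ord.leadingTerm '' (I : Set (MvPolynomial (Fin n) k)))

/-- The ideal `I` (or its quotient ring) is G-quadratic: after a linear change of coordinates
`φ` it has, for some monomial order, a Gröbner basis consisting of quadrics. -/
def IsGQuadratic {k : Type*} [Field k] {n : ℕ} (I : Ideal (MvPolynomial (Fin n) k)) : Prop :=
  ∃ (φ : MvPolynomial (Fin n) k ≃ₐ[k] MvPolynomial (Fin n) k)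
    (ord : MonomialOrder.{0, 0} (Fin n)) (G : Finset (MvPolynomial (Fin n) k)),
    (∀ i, (φ (MvPolynomial.X i)).IsHomogeneous 1) ∧
    (∀ g ∈ G, g.IsHomogeneous 2) ∧
    IsGroebnerBasis ord G (I.map φ)

/-- `k[x₁, …, xₙ]/I` is isomorphic, as a graded `k`-algebra, to the quotient of
`A = k[y₁, …, yₘ]/J` by an `A`-regular sequence of linear forms. The isomorphism is graded because
it takes the classes of the variables, which generate the source, to classes of linear forms. -/
def IsQuotientByRegularLinearForms {k : Type*} [Field k] {m n : ℕ}
    (J : Ideal (MvPolynomial (Fin m) k)) (I : Ideal (MvPolynomial (Fin n) k)) : Prop :=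
  ∃ l : List (MvPolynomial (Fin m) k),
    (∀ f ∈ l, f.IsHomogeneous 1) ∧
    RingTheory.Sequence.IsRegular (MvPolynomial (Fin m) k ⧸ J) l ∧
    ∃ e : (MvPolynomial (Fin m) k ⧸ (J ⊔ Ideal.ofList l)) ≃ₐ[k] (MvPolynomial (Fin n) k ⧸ I),
      ∀ i, ∃ f : MvPolynomial (Fin n) k, f.IsHomogeneous 1 ∧
        e (Ideal.Quotient.mk _ (MvPolynomial.X i)) = Ideal.Quotient.mk I f

/-- The ideal `I` (or its quotient ring) is LG-quadratic: the quotient ring is the quotient of a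
G-quadratic algebra `A` by an `A`-regular sequence of linear forms. -/
def IsLGQuadratic {k : Type*} [Field k] {n : ℕ} (I : Ideal (MvPolynomial (Fin n) k)) : Prop :=
  ∃ (m : ℕ) (J : Ideal (MvPolynomial (Fin m) k)),
    IsGQuadratic J ∧ IsQuotientByRegularLinearForms J I

end LGQuadratic

/-!
The common idea is to lift `I₁ + I₂` to a polynomial ring with two more variables `A` and `B`, one
for each summand, in which the lifted ideal visibly has a quadratic Gröbner basis.

A height one ideal generated by quadrics lies in a principal prime `(p)`, and `p` is homogeneous as
a factor of a homogeneous polynomial. Hence either the ideal is `(q)` for an irreducible quadric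
`q`, or it is `aL` with `a` a linear form and `L` an ideal generated by linear forms
(`GeneratedByQuadrics.eq_span_or_eq_mul`). The ideal `aL` is the section `A = a` of `AL`
(`linearCone`), and `(q)` is the section `A = 0` of `(A² + q)` (`squareCone`). The same two
constructions with `B` lift the second summand.

The linear forms `A - a` (or `A`) and `B - b` (or `B`) form a regular sequence: for one extra
variable this is `isRegularSection_linearCone` and `isRegularSection_squareCone`, which require only
that `a` (or `q`) be a nonzerodivisor modulo the other summand. Comparing degrees in
`I₁ ∩ I₂ = I₁I₂` gives these conditions. For `aL` and `bM` it yields `a ∉ M`, `b ∉ L`, `b ∤ a`, and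
that the linear forms in `L` and `M` are independent, so that after a linear change of coordinates
`L` and `M` are generated by variables and `AL + BM` is a monomial ideal.

The other lifts, `(A² + q) + BM` and `(A² + q₁, B² + q₂)`, have quadratic Gröbner bases for the
lexicographic order with `A` and `B` largest. This follows from `IsGroebnerBasis.squareCone`: if `f`
lies in `J₀ + (A² + q)` then either `A²` divides the leading term of `f`, or `f` has degree at most
one in `A` and all its coefficients lie in `J₀`, by uniqueness of remainders modulo a monic
polynomial.
-/

namespace LGQuadratic

open MvPolynomial

variable {k : Type*} [Field k] {n : ℕ}

/-! ### Specializing one variable -/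

lemma finSuccEquiv_rename_succ (p : MvPolynomial (Fin n) k) :
    finSuccEquiv k n (rename Fin.succ p) = Polynomial.C p := by
  induction p using MvPolynomial.induction_on with
  | C a => simp [finSuccEquiv_apply]
  | add p q hp hq => simp [hp, hq]
  | mul_X p i hp => simp [hp, finSuccEquiv_X_succ]

lemma mem_map_rename_succ {J : Ideal (MvPolynomial (Fin n) k)} {f : MvPolynomial (Fin (n + 1)) k} :
    f ∈ J.map (rename (R := k) (Fin.succ : Fin n → Fin (n + 1))) ↔
      ∀ i, (finSuccEquiv k n f).coeff i ∈ J := by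
  rw [← Ideal.mem_map_C_iff]
  have h : (J.map (rename (R := k) (Fin.succ : Fin n → Fin (n + 1)))).map (finSuccEquiv k n) =
      J.map Polynomial.C := by
    have := Ideal.map_map (I := J)
      (rename (R := k) (Fin.succ : Fin n → Fin (n + 1))).toRingHom
      (finSuccEquiv k n).toAlgHom.toRingHom
    refine this.trans ?_
    congr 1
    exact RingHom.ext finSuccEquiv_rename_succ
  rw [← h]
  constructor
  · exact fun hf => Ideal.mem_map_of_mem _ hf
  · intro hf
    obtain ⟨g, hg, hgf⟩ := (Ideal.mem_map_of_equiv (finSuccEquiv k n) _).1 hf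
    rwa [← (finSuccEquiv k n).injective hgf]

/-- The substitution of `a` for the variable `X 0`; the other variables are shifted down by one. -/
noncomputable def specialize (a : MvPolynomial (Fin n) k) :
    MvPolynomial (Fin (n + 1)) k →ₐ[k] MvPolynomial (Fin n) k :=
  aeval (Fin.cons a X)

@[simp] lemma specialize_X_zero (a : MvPolynomial (Fin n) k) : specialize a (X 0) = a := by
  simp [specialize]

@[simp] lemma specialize_X_succ (a : MvPolynomial (Fin n) k) (i : Fin n) :
    specialize a (X i.succ) = X i := by
  simp [specialize]

@[simp] lemma specialize_rename_succ (a p : MvPolynomial (Fin n) k) :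
    specialize a (rename Fin.succ p) = p := by
  simp only [specialize, aeval_rename]
  have : (Fin.cons a X : Fin (n + 1) → MvPolynomial (Fin n) k) ∘ Fin.succ = X := by
    ext1 i; simp
  rw [this, aeval_X_left_apply]

lemma specialize_surjective (a : MvPolynomial (Fin n) k) : Function.Surjective (specialize a) :=
  fun p => ⟨_, specialize_rename_succ a p⟩

lemma map_specialize_map_rename (a : MvPolynomial (Fin n) k) (J : Ideal (MvPolynomial (Fin n) k)) :
    (J.map (rename (R := k) (Fin.succ : Fin n → Fin (n + 1)))).map (specialize a) = J := by
  have := Ideal.map_map (I := J)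
      (rename (R := k) (Fin.succ : Fin n → Fin (n + 1))).toRingHom (specialize a).toRingHom
  refine this.trans ?_
  have h : (specialize a).toRingHom.comp
      (rename (R := k) (Fin.succ : Fin n → Fin (n + 1))).toRingHom = RingHom.id _ :=
    RingHom.ext (specialize_rename_succ a)
  rw [h, Ideal.map_id]

lemma specialize_eq_eval (a : MvPolynomial (Fin n) k) (f : MvPolynomial (Fin (n + 1)) k) :
    specialize a f = (finSuccEquiv k n f).eval a := by
  induction f using MvPolynomial.induction_on with
  | C c => simp [finSuccEquiv_apply, specialize, algebraMap_eq]
  | add p q hp hq => simp [hp, hq]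
  | mul_X p i hp =>
    refine Fin.cases ?_ (fun j => ?_) i
    · simp [hp, finSuccEquiv_X_zero]
    · simp [hp, finSuccEquiv_X_succ]

lemma dvd_sub_rename_specialize (a : MvPolynomial (Fin n) k) (f : MvPolynomial (Fin (n + 1)) k) :
    X 0 - rename Fin.succ a ∣ f - rename Fin.succ (specialize a f) := by
  rw [← map_dvd_iff (finSuccEquiv k n)]
  simp only [map_sub, finSuccEquiv_rename_succ, finSuccEquiv_X_zero, specialize_eq_eval]
  exact Polynomial.X_sub_C_dvd_sub_C_eval

/-- The kernel of `specialize a` is generated by `X 0 - a`. -/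
lemma mem_sup_span_iff (a : MvPolynomial (Fin n) k) (J : Ideal (MvPolynomial (Fin (n + 1)) k))
    (f : MvPolynomial (Fin (n + 1)) k) :
    f ∈ J ⊔ Ideal.span {X 0 - rename Fin.succ a} ↔ specialize a f ∈ J.map (specialize a) := by
  constructor
  · intro hf
    obtain ⟨j, hj, g, hg, rfl⟩ := Submodule.mem_sup.1 hf
    obtain ⟨c, rfl⟩ := Ideal.mem_span_singleton.1 hg
    simpa using Ideal.mem_map_of_mem (specialize a) hj
  · intro hf
    obtain ⟨j, hj, hjf⟩ := (Ideal.mem_map_iff_of_surjective _ (specialize_surjective a)).1 hf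
    have h := dvd_sub_rename_specialize a (f - j)
    rw [map_sub, hjf, sub_self, map_zero, sub_zero] at h
    rw [← add_sub_cancel j f]
    exact Submodule.add_mem_sup hj (Ideal.mem_span_singleton.2 h)

/-- Multiplication by `c` is injective on `R ⧸ J`. -/
def NonzerodivisorMod {R : Type*} [CommRing R] (J : Ideal R) (c : R) : Prop :=
  ∀ f, c * f ∈ J → f ∈ J

/-- The linear section `X 0 = a` of `k[X 0, …, X n]/J` is `k[X 0, …, X (n - 1)]/I`, and
`X 0 - a` is a nonzerodivisor modulo `J`. -/
structure IsRegularSection (J : Ideal (MvPolynomial (Fin (n + 1)) k)) (a : MvPolynomial (Fin n) k)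
    (I : Ideal (MvPolynomial (Fin n) k)) : Prop where
  nonzerodivisor : NonzerodivisorMod J (X 0 - rename Fin.succ a)
  map_eq : J.map (specialize a) = I

lemma isSMulRegular_quotient {R : Type*} [CommRing R] {J : Ideal R} {c : R}
    (h : NonzerodivisorMod J c) : IsSMulRegular (R ⧸ J) c := by
  rw [isSMulRegular_quotient_iff_mem_of_smul_mem]
  exact h

lemma isRegular_pair {R : Type*} [CommRing R] {J : Ideal R} {r s : R}
    (hr : NonzerodivisorMod J r) (hs : NonzerodivisorMod (J ⊔ Ideal.span {r}) s)
    (htop : J ⊔ Ideal.ofList [r, s] ≠ ⊤) :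
    RingTheory.Sequence.IsRegular (R ⧸ J) [r, s] := by
  have key : ∀ (K : Ideal R) (f : R), Ideal.Quotient.mk J f ∈ (K • ⊤ : Submodule R (R ⧸ J)) ↔
      f ∈ J ⊔ K := by
    intro K f
    have : (K • ⊤ : Submodule R (R ⧸ J)) = (K.map (Ideal.Quotient.mk J)).restrictScalars R := by
      simp
    rw [this, Submodule.restrictScalars_mem, Ideal.mem_map_iff_of_surjective _
      Ideal.Quotient.mk_surjective]
    constructor
    · rintro ⟨x, hx, hxf⟩
      have : f - x ∈ J := by
        rw [← Ideal.Quotient.eq, hxf]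
      rw [← sub_add_cancel f x]
      exact Submodule.add_mem_sup this hx
    · intro hf
      obtain ⟨j, hj, x, hx, rfl⟩ := Submodule.mem_sup.1 hf
      exact ⟨x, hx, by simp [Ideal.Quotient.eq_zero_iff_mem.2 hj]⟩
  refine ⟨?_, ?_⟩
  · rw [show [r, s] = [r] ++ [s] from rfl, RingTheory.Sequence.isWeaklyRegular_append_iff,
      RingTheory.Sequence.isWeaklyRegular_singleton_iff,
      RingTheory.Sequence.isWeaklyRegular_singleton_iff]
    refine ⟨isSMulRegular_quotient hr, ?_⟩
    rw [isSMulRegular_quotient_iff_mem_of_smul_mem]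
    intro x hx
    obtain ⟨f, rfl⟩ := Ideal.Quotient.mk_surjective x
    rw [key, Ideal.ofList_singleton]
    have h2 : s • Ideal.Quotient.mk J f = Ideal.Quotient.mk J (s * f) := rfl
    rw [h2, key, Ideal.ofList_singleton] at hx
    exact hs f hx
  · intro h
    apply htop
    rw [Ideal.eq_top_iff_one, ← key, ← h]
    trivial

lemma isHomogeneous_specialize_X {a : MvPolynomial (Fin n) k} (ha : a.IsHomogeneous 1)
    (i : Fin (n + 1)) : (specialize a (X i)).IsHomogeneous 1 := by
  refine Fin.cases ?_ (fun j => ?_) i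
  · simpa using ha
  · simpa using isHomogeneous_X k j

/-- Two successive regular sections present `k[x]/I` as a quotient by a regular sequence of two
linear forms. -/
lemma IsRegularSection.isQuotientByRegularLinearForms
    {J : Ideal (MvPolynomial (Fin (n + 2)) k)} {J' : Ideal (MvPolynomial (Fin (n + 1)) k)}
    {I : Ideal (MvPolynomial (Fin n) k)} {a b : MvPolynomial (Fin n) k}
    (hJ : IsRegularSection J (rename Fin.succ a) J') (hJ' : IsRegularSection J' b I)
    (ha : a.IsHomogeneous 1) (hb : b.IsHomogeneous 1) (hI : I ≠ ⊤) :
    IsQuotientByRegularLinearForms J I := by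
  have ha' : (rename (Fin.succ : Fin n → Fin (n + 1)) a).IsHomogeneous 1 :=
    ha.rename_isHomogeneous
  set r : MvPolynomial (Fin (n + 2)) k := X 0 - rename Fin.succ (rename Fin.succ a) with hr
  set s : MvPolynomial (Fin (n + 2)) k := rename Fin.succ (X 0 - rename Fin.succ b) with hs
  set p : MvPolynomial (Fin (n + 2)) k →ₐ[k] MvPolynomial (Fin n) k :=
    (specialize b).comp (specialize (rename Fin.succ a)) with hp
  have hps : Function.Surjective p := by
    rw [hp, AlgHom.coe_comp]
    exact (specialize_surjective b).comp (specialize_surjective _)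
  have hmem : ∀ f, f ∈ J ⊔ Ideal.ofList [r, s] ↔ p f ∈ I := by
    intro f
    have h1 : J ⊔ Ideal.ofList [r, s] = (J ⊔ Ideal.span {s}) ⊔ Ideal.span {r} := by
      rw [Ideal.ofList_cons, Ideal.ofList_singleton, sup_assoc, sup_comm (Ideal.span {s})]
    rw [h1, mem_sup_span_iff, Ideal.map_sup, hJ.map_eq, Ideal.map_span, Set.image_singleton, hs,
      specialize_rename_succ, mem_sup_span_iff, hJ'.map_eq]
    rfl
  refine ⟨[r, s], ?_, ?_, ?_⟩
  · simp only [List.mem_cons, List.not_mem_nil, or_false, forall_eq_or_imp, forall_eq]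
    exact ⟨(isHomogeneous_X k 0).sub ha'.rename_isHomogeneous,
      ((isHomogeneous_X k 0).sub hb.rename_isHomogeneous).rename_isHomogeneous⟩
  · refine isRegular_pair hJ.nonzerodivisor ?_ ?_
    · intro f hf
      rw [mem_sup_span_iff, hJ.map_eq] at hf ⊢
      refine hJ'.nonzerodivisor _ ?_
      rwa [map_mul, hs, specialize_rename_succ] at hf
    · rw [Ne, Ideal.eq_top_iff_one, hmem, map_one, ← Ideal.eq_top_iff_one]
      exact hI
  · have hker : RingHom.ker ((Ideal.Quotient.mkₐ k I).comp p) = J ⊔ Ideal.ofList [r, s] := by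
      ext f
      rw [hmem, RingHom.mem_ker, AlgHom.comp_apply, Ideal.Quotient.mkₐ_eq_mk,
        Ideal.Quotient.eq_zero_iff_mem]
    refine ⟨(Ideal.quotientEquivAlgOfEq k hker.symm).trans (Ideal.quotientKerAlgEquivOfSurjective
      ((Ideal.Quotient.mkₐ_surjective k I).comp hps)), fun i => ⟨p (X i), ?_, rfl⟩⟩
    simpa [hp, specialize] using
      (isHomogeneous_specialize_X ha' i).aeval _ (isHomogeneous_specialize_X hb)

/-! ### Cones over ideals -/

/-- The ideal `J₀ + X 0 · L` of `k[X 0, …, X n]`, where `J₀` and `L` are ideals in the variables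
other than `X 0`. -/
noncomputable def linearCone (J₀ L : Ideal (MvPolynomial (Fin n) k)) :
    Ideal (MvPolynomial (Fin (n + 1)) k) :=
  J₀.map (rename (R := k) (Fin.succ : Fin n → Fin (n + 1))) ⊔
    Ideal.span {X 0} * L.map (rename (R := k) (Fin.succ : Fin n → Fin (n + 1)))

/-- The ideal `J₀ + (X 0 ^ 2 + q)` of `k[X 0, …, X n]`, where `J₀` and `q` live in the variables
other than `X 0`. -/
noncomputable def squareCone (J₀ : Ideal (MvPolynomial (Fin n) k)) (q : MvPolynomial (Fin n) k) :
    Ideal (MvPolynomial (Fin (n + 1)) k) :=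
  J₀.map (rename (R := k) (Fin.succ : Fin n → Fin (n + 1))) ⊔
    Ideal.span {X 0 ^ 2 + rename Fin.succ q}

lemma map_specialize_linearCone (J₀ L : Ideal (MvPolynomial (Fin n) k))
    (a : MvPolynomial (Fin n) k) :
    (linearCone J₀ L).map (specialize a) = J₀ ⊔ Ideal.span {a} * L := by
  rw [linearCone, Ideal.map_sup, Ideal.map_mul, map_specialize_map_rename,
    map_specialize_map_rename, Ideal.map_span, Set.image_singleton, specialize_X_zero]

lemma map_specialize_squareCone (J₀ : Ideal (MvPolynomial (Fin n) k))
    (q : MvPolynomial (Fin n) k) :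
    (squareCone J₀ q).map (specialize 0) = J₀ ⊔ Ideal.span {q} := by
  rw [squareCone, Ideal.map_sup, map_specialize_map_rename, Ideal.map_span, Set.image_singleton]
  simp

/-- Membership in `linearCone J₀ L`, read off the coefficients with respect to `X 0`. -/
lemma mem_linearCone {J₀ L : Ideal (MvPolynomial (Fin n) k)} {f : MvPolynomial (Fin (n + 1)) k} :
    f ∈ linearCone J₀ L ↔ (finSuccEquiv k n f).coeff 0 ∈ J₀ ∧
      ∀ i, (finSuccEquiv k n f).coeff (i + 1) ∈ J₀ ⊔ L := by
  constructor
  · intro hf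
    obtain ⟨g, hg, h, hh, rfl⟩ := Submodule.mem_sup.1 hf
    obtain ⟨z, hz, rfl⟩ := Ideal.mem_span_singleton_mul.1 hh
    rw [mem_map_rename_succ] at hg hz
    simp only [map_add, map_mul, finSuccEquiv_X_zero, Polynomial.coeff_add,
      Polynomial.coeff_X_mul_zero, add_zero, Polynomial.coeff_X_mul]
    exact ⟨hg 0, fun i => Submodule.add_mem_sup (hg _) (hz i)⟩
  · rintro ⟨h0, h1⟩
    set g := (finSuccEquiv k n).symm (finSuccEquiv k n f).divX with hg
    have hf : f = rename Fin.succ ((finSuccEquiv k n f).coeff 0) + X 0 * g := by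
      apply (finSuccEquiv k n).injective
      rw [map_add, map_mul, finSuccEquiv_X_zero, finSuccEquiv_rename_succ, hg,
        AlgEquiv.apply_symm_apply]
      exact ((add_comm _ _).trans (Polynomial.X_mul_divX_add _)).symm
    have hgm : g ∈ (J₀ ⊔ L).map (rename (R := k) (Fin.succ : Fin n → Fin (n + 1))) := by
      rw [mem_map_rename_succ, hg, AlgEquiv.apply_symm_apply]
      simpa using h1
    rw [Ideal.map_sup] at hgm
    obtain ⟨u, hu, v, hv, huv⟩ := Submodule.mem_sup.1 hgm
    rw [hf, ← huv, mul_add, ← add_assoc]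
    exact Submodule.add_mem_sup
      (Ideal.add_mem _ (Ideal.mem_map_of_mem _ h0) (Ideal.mul_mem_left _ _ hu))
      (Ideal.mul_mem_mul (Ideal.mem_span_singleton_self _) hv)

/-- Membership in `squareCone J₀ q` is divisibility by a monic polynomial over `k[x]/J₀`. -/
lemma mem_squareCone {J₀ : Ideal (MvPolynomial (Fin n) k)} {q : MvPolynomial (Fin n) k}
    {f : MvPolynomial (Fin (n + 1)) k} :
    f ∈ squareCone J₀ q ↔ Polynomial.X ^ 2 + Polynomial.C (Ideal.Quotient.mk J₀ q) ∣
      (finSuccEquiv k n f).map (Ideal.Quotient.mk J₀) := by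
  have key : ∀ g : MvPolynomial (Fin (n + 1)) k,
      (finSuccEquiv k n g).map (Ideal.Quotient.mk J₀) = 0 ↔
        g ∈ J₀.map (rename (R := k) (Fin.succ : Fin n → Fin (n + 1))) := by
    intro g
    simp [mem_map_rename_succ, Polynomial.ext_iff, Ideal.Quotient.eq_zero_iff_mem]
  constructor
  · intro hf
    obtain ⟨g, hg, h, hh, rfl⟩ := Submodule.mem_sup.1 hf
    obtain ⟨z, rfl⟩ := Ideal.mem_span_singleton.1 hh
    rw [map_add, Polynomial.map_add, (key g).2 hg, zero_add, map_mul, Polynomial.map_mul]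
    refine Dvd.intro _ (congrArg (· * _) ?_)
    simp [finSuccEquiv_X_zero, finSuccEquiv_rename_succ]
  · rintro ⟨z, hz⟩
    obtain ⟨y, rfl⟩ := Polynomial.map_surjective _ Ideal.Quotient.mk_surjective z
    obtain ⟨w, rfl⟩ := (finSuccEquiv k n).surjective y
    rw [← sub_add_cancel f ((X 0 ^ 2 + rename Fin.succ q) * w)]
    refine Submodule.add_mem_sup ((key _).1 ?_) (Ideal.mul_mem_right _ _
      (Ideal.mem_span_singleton_self _))
    simp [hz, finSuccEquiv_X_zero, finSuccEquiv_rename_succ]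

/-- In positive degrees in `X 0` membership in the cone means having coefficients in `J₀ + L`, and
`X 0 - a` is monic in `X 0`, so descending induction on the degree applies; the assumption on `a` is
needed for the constant coefficient only. -/
lemma isRegularSection_linearCone {J₀ : Ideal (MvPolynomial (Fin n) k)}
    (L : Ideal (MvPolynomial (Fin n) k)) {a : MvPolynomial (Fin n) k}
    (ha : NonzerodivisorMod J₀ a) :
    IsRegularSection (linearCone J₀ L) a (J₀ ⊔ Ideal.span {a} * L) := by
  refine ⟨fun f hf => ?_, map_specialize_linearCone J₀ L a⟩
  rw [mem_linearCone] at hf ⊢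
  simp only [map_mul, map_sub, finSuccEquiv_X_zero, finSuccEquiv_rename_succ, sub_mul,
    Polynomial.coeff_sub, Polynomial.coeff_X_mul_zero, Polynomial.coeff_C_mul, zero_sub,
    neg_mem_iff, Polynomial.coeff_X_mul] at hf
  refine ⟨ha _ hf.1, fun i => ?_⟩
  suffices h : ∀ d i, (finSuccEquiv k n f).natDegree < i + d →
      (finSuccEquiv k n f).coeff i ∈ J₀ ⊔ L from
    h ((finSuccEquiv k n f).natDegree + 1) _ (by omega)
  intro d
  induction d with
  | zero =>
    intro i hi
    rw [Polynomial.coeff_eq_zero_of_natDegree_lt (by simpa using hi)]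
    exact Ideal.zero_mem _
  | succ d ih =>
    intro i hi
    have h1 := hf.2 i
    have h2 := Ideal.mul_mem_left _ a (ih (i + 1) (by omega))
    simpa using Ideal.add_mem _ h1 h2

lemma isRegularSection_squareCone {J₀ : Ideal (MvPolynomial (Fin n) k)}
    {q : MvPolynomial (Fin n) k} (hq : NonzerodivisorMod J₀ q) :
    IsRegularSection (squareCone J₀ q) 0 (J₀ ⊔ Ideal.span {q}) := by
  refine ⟨fun f hf => ?_, map_specialize_squareCone J₀ q⟩
  rw [mem_squareCone] at hf ⊢
  simp only [map_zero, sub_zero, map_mul, finSuccEquiv_X_zero, Polynomial.map_mul,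
    Polynomial.map_X] at hf
  obtain ⟨g, hg⟩ := hf
  have h0 : Polynomial.X ∣ g := by
    rw [Polynomial.X_dvd_iff]
    have := congrArg (Polynomial.coeff · 0) hg
    simp only [Polynomial.mul_coeff_zero, Polynomial.coeff_X_zero, zero_mul,
      Polynomial.coeff_add, Polynomial.coeff_C_zero] at this
    obtain ⟨c, hc⟩ := Ideal.Quotient.mk_surjective (g.coeff 0)
    rw [← hc] at this ⊢
    rw [Ideal.Quotient.eq_zero_iff_mem]
    apply hq
    rw [← Ideal.Quotient.eq_zero_iff_mem, map_mul, this]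
    simp
  obtain ⟨h, rfl⟩ := h0
  refine ⟨h, ?_⟩
  exact Polynomial.isRegular_X.left (hg.trans (by ring))

lemma nonzerodivisorMod_linearCone {J₀ L : Ideal (MvPolynomial (Fin n) k)}
    {c : MvPolynomial (Fin n) k} (h₀ : NonzerodivisorMod J₀ c)
    (h₁ : NonzerodivisorMod (J₀ ⊔ L) c) :
    NonzerodivisorMod (linearCone J₀ L) (rename Fin.succ c) := by
  intro f hf
  rw [mem_linearCone] at hf ⊢
  simp only [map_mul, finSuccEquiv_rename_succ, Polynomial.coeff_C_mul] at hf
  exact ⟨h₀ _ hf.1, fun i => h₁ _ (hf.2 i)⟩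

/-- Modulo `J₀`, the quotient by the monic polynomial `X 0 ^ 2 + q` is free. -/
lemma nonzerodivisorMod_squareCone {J₀ : Ideal (MvPolynomial (Fin n) k)}
    (q : MvPolynomial (Fin n) k) {c : MvPolynomial (Fin n) k} (h₀ : NonzerodivisorMod J₀ c) :
    NonzerodivisorMod (squareCone J₀ q) (rename Fin.succ c) := by
  intro f hf
  have hmonic : (Polynomial.X ^ 2 + Polynomial.C (Ideal.Quotient.mk J₀ q)).Monic :=
    Polynomial.monic_X_pow_add_C _ two_ne_zero
  rw [mem_squareCone, ← Polynomial.modByMonic_eq_zero_iff_dvd hmonic] at hf ⊢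
  rw [map_mul, finSuccEquiv_rename_succ, Polynomial.map_mul, Polynomial.map_C,
    ← Polynomial.smul_eq_C_mul, Polynomial.smul_modByMonic] at hf
  ext i
  have := congrArg (Polynomial.coeff · i) hf
  simp only [Polynomial.coeff_smul, smul_eq_mul, Polynomial.coeff_zero] at this ⊢
  obtain ⟨d, hd⟩ := Ideal.Quotient.mk_surjective
    (((finSuccEquiv k n f).map (Ideal.Quotient.mk J₀) %ₘ
      (Polynomial.X ^ 2 + Polynomial.C (Ideal.Quotient.mk J₀ q))).coeff i)
  rw [← hd, ← map_mul, Ideal.Quotient.eq_zero_iff_mem] at this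
  rw [← hd, Ideal.Quotient.eq_zero_iff_mem]
  exact h₀ _ this

/-- A polynomial of degree at most one in `X 0` is its own remainder modulo the monic polynomial
`X 0 ^ 2 + q`, so that it lies in `squareCone J₀ q` only if its coefficients lie in `J₀`. -/
lemma coeff_mem_of_mem_squareCone {J₀ : Ideal (MvPolynomial (Fin n) k)}
    {q : MvPolynomial (Fin n) k} {f : MvPolynomial (Fin (n + 1)) k} (hf : f ∈ squareCone J₀ q)
    (hdeg : (finSuccEquiv k n f).natDegree < 2) (i : ℕ) : (finSuccEquiv k n f).coeff i ∈ J₀ := by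
  by_cases hJ : J₀ = ⊤
  · simp [hJ]
  have : Nontrivial (MvPolynomial (Fin n) k ⧸ J₀) := Ideal.Quotient.nontrivial_iff.2 hJ
  have hmonic : (Polynomial.X ^ 2 + Polynomial.C (Ideal.Quotient.mk J₀ q)).Monic :=
    Polynomial.monic_X_pow_add_C _ two_ne_zero
  rw [mem_squareCone] at hf
  by_contra h
  refine hmonic.not_dvd_of_natDegree_lt (fun h0 => h ?_) ?_ hf
  · have := congrArg (Polynomial.coeff · i) h0
    simpa [Ideal.Quotient.eq_zero_iff_mem] using this
  · rw [Polynomial.natDegree_X_pow_add_C]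
    exact Polynomial.natDegree_map_le.trans_lt hdeg

/-! ### Lexicographic Gröbner bases -/

open scoped MonomialOrder

lemma toLex_cons_lt_of_lt {a b : ℕ} (h : a < b) (s t : Fin n →₀ ℕ) :
    toLex (Finsupp.cons a s) < toLex (Finsupp.cons b t) :=
  Finsupp.Lex.lt_iff.2 ⟨0, fun j hj => absurd hj (Fin.not_lt_zero j), by simpa using h⟩

lemma toLex_cons_le_of_le (a : ℕ) {s t : Fin n →₀ ℕ} (h : toLex s ≤ toLex t) :
    toLex (Finsupp.cons a s) ≤ toLex (Finsupp.cons a t) := by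
  rcases h.eq_or_lt with h | h
  · rw [toLex_inj.1 h]
  · obtain ⟨i, hi, hlt⟩ := Finsupp.Lex.lt_iff.1 h
    refine (Finsupp.Lex.lt_iff.2 ⟨i.succ, fun j => ?_, by simpa using hlt⟩).le
    refine Fin.cases (fun _ => by simp) (fun j hj => ?_) j
    simpa using hi j (Fin.succ_lt_succ_iff.1 hj)

/-- In the lexicographic order the variable `X 0` dominates: the leading exponent is read off the
leading coefficient with respect to `X 0`. -/
lemma lex_degree_eq_cons {f : MvPolynomial (Fin (n + 1)) k} (hf : f ≠ 0) :
    MonomialOrder.lex.degree f = Finsupp.cons (finSuccEquiv k n f).natDegree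
      (MonomialOrder.lex.degree (finSuccEquiv k n f).leadingCoeff) := by
  have hf' : finSuccEquiv k n f ≠ 0 := by simpa using hf
  apply MonomialOrder.lex.toSyn.injective
  apply le_antisymm
  · rw [MonomialOrder.degree_le_iff]
    intro b hb
    rw [MonomialOrder.lex_le_iff, ← Finsupp.cons_tail b]
    rw [← Finsupp.cons_tail b, ← mem_support_coeff_finSuccEquiv] at hb
    have hle : b 0 ≤ (finSuccEquiv k n f).natDegree :=
      Polynomial.le_natDegree_of_ne_zero (fun h => by simp [h] at hb)
    rcases hle.lt_or_eq with h | h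
    · exact (toLex_cons_lt_of_lt h _ _).le
    · rw [h] at hb ⊢
      exact toLex_cons_le_of_le _ (MonomialOrder.lex.le_degree hb)
  · apply MonomialOrder.le_degree
    rw [← mem_support_coeff_finSuccEquiv]
    exact MonomialOrder.lex.degree_mem_support (Polynomial.leadingCoeff_ne_zero.2 hf')

lemma X_zero_pow_mul_rename_monomial (d : ℕ) (s : Fin n →₀ ℕ) (c : k) :
    X 0 ^ d * rename Fin.succ (monomial s c) = monomial (Finsupp.cons d s) c := by
  apply (finSuccEquiv k n).injective
  ext i m
  rw [finSuccEquiv_coeff_coeff (f := monomial _ c), map_mul, map_pow, finSuccEquiv_X_zero,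
    finSuccEquiv_rename_succ, Polynomial.coeff_X_pow_mul', coeff_monomial]
  split_ifs with h1 h2 h2
  · obtain ⟨rfl, rfl⟩ := Finsupp.cons_injective2 h2
    simp
  · rw [Polynomial.coeff_C]
    split_ifs with h3
    · obtain rfl : i = d := by omega
      rw [coeff_monomial, if_neg]
      rintro rfl
      exact h2 rfl
    · simp
  · obtain ⟨rfl, rfl⟩ := Finsupp.cons_injective2 h2
    simp at h1
  · simp

lemma lex_leadingTerm_eq {f : MvPolynomial (Fin (n + 1)) k} (hf : f ≠ 0) :
    MonomialOrder.lex.leadingTerm f = X 0 ^ (finSuccEquiv k n f).natDegree *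
      rename Fin.succ (MonomialOrder.lex.leadingTerm (finSuccEquiv k n f).leadingCoeff) := by
  rw [MonomialOrder.leadingTerm, MonomialOrder.leadingTerm, X_zero_pow_mul_rename_monomial,
    ← lex_degree_eq_cons hf]
  congr 1
  rw [MonomialOrder.leadingCoeff, lex_degree_eq_cons hf, ← finSuccEquiv_coeff_coeff]
  rfl

lemma lex_leadingTerm_rename_succ (g : MvPolynomial (Fin n) k) :
    MonomialOrder.lex.leadingTerm (rename (Fin.succ : Fin n → Fin (n + 1)) g) =
      rename Fin.succ (MonomialOrder.lex.leadingTerm g) := by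
  by_cases hg : g = 0
  · simp [hg]
  · rw [lex_leadingTerm_eq (by simpa [rename_eq_zero_iff_of_injective _ (Fin.succ_injective n)]
      using hg), finSuccEquiv_rename_succ]
    simp

lemma lex_leadingTerm_X_sq_add (q : MvPolynomial (Fin n) k) :
    MonomialOrder.lex.leadingTerm (X 0 ^ 2 + rename Fin.succ q : MvPolynomial (Fin (n + 1)) k) =
      X 0 ^ 2 := by
  have h : finSuccEquiv k n (X 0 ^ 2 + rename Fin.succ q) =
      Polynomial.X ^ 2 + Polynomial.C q := by
    simp [finSuccEquiv_X_zero, finSuccEquiv_rename_succ]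
  have hm : (Polynomial.X ^ 2 + Polynomial.C q).Monic := Polynomial.monic_X_pow_add_C _ two_ne_zero
  rw [lex_leadingTerm_eq, h, hm.leadingCoeff, Polynomial.natDegree_X_pow_add_C]
  · rw [← C_1, MonomialOrder.leadingTerm_C]
    simp
  · intro h0
    rw [h0, map_zero] at h
    exact hm.ne_zero h.symm

lemma X_sq_add_ne_zero (q : MvPolynomial (Fin n) k) :
    (X 0 ^ 2 + rename Fin.succ q : MvPolynomial (Fin (n + 1)) k) ≠ 0 := by
  intro h
  have := lex_leadingTerm_X_sq_add q
  rw [h, MonomialOrder.leadingTerm_zero] at this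
  exact pow_ne_zero 2 (X_ne_zero 0) this.symm

lemma isGroebnerBasis_of_leadingTerm_mem {ord : MonomialOrder.{0, 0} (Fin n)}
    {G : Finset (MvPolynomial (Fin n) k)} {I : Ideal (MvPolynomial (Fin n) k)}
    (h₀ : ∀ g ∈ G, g ≠ 0) (h₁ : ∀ g ∈ G, g ∈ I)
    (h : ∀ f ∈ I, f ≠ 0 → ord.leadingTerm f ∈
      Ideal.span (ord.leadingTerm '' (G : Set (MvPolynomial (Fin n) k)))) :
    IsGroebnerBasis ord G I := by
  refine ⟨h₀, h₁, le_antisymm (Ideal.span_mono (Set.image_mono h₁)) (Ideal.span_le.2 ?_)⟩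
  rintro _ ⟨f, hf, rfl⟩
  by_cases h0 : f = 0
  · simp [h0]
  · exact h f hf h0

/-- Adjoining `X 0 ^ 2 + q` with `X 0` the largest variable keeps a Gröbner basis: an element of
`squareCone J₀ q` of degree at most one in `X 0` has all its coefficients in `J₀`. -/
lemma IsGroebnerBasis.squareCone {G : Finset (MvPolynomial (Fin n) k)}
    {J₀ : Ideal (MvPolynomial (Fin n) k)} (hG : IsGroebnerBasis MonomialOrder.lex G J₀)
    (q : MvPolynomial (Fin n) k) [DecidableEq (MvPolynomial (Fin (n + 1)) k)] :
    IsGroebnerBasis MonomialOrder.lex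
      (insert (X 0 ^ 2 + rename Fin.succ q) (G.image (rename Fin.succ))) (squareCone J₀ q) := by
  apply isGroebnerBasis_of_leadingTerm_mem
  · intro g hg
    rcases Finset.mem_insert.1 hg with rfl | hg
    · exact X_sq_add_ne_zero q
    · obtain ⟨g, hg', rfl⟩ := Finset.mem_image.1 hg
      rw [Ne, rename_eq_zero_iff_of_injective _ (Fin.succ_injective n)]
      exact hG.ne_zero g hg'
  · intro g hg
    rcases Finset.mem_insert.1 hg with rfl | hg
    · exact Ideal.mem_sup_right (Ideal.mem_span_singleton_self _)
    · obtain ⟨g, hg', rfl⟩ := Finset.mem_image.1 hg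
      exact Ideal.mem_sup_left (Ideal.mem_map_of_mem _ (hG.subset g hg'))
  · intro f hf h0
    rw [lex_leadingTerm_eq h0]
    by_cases hdeg : (finSuccEquiv k n f).natDegree < 2
    · apply Ideal.mul_mem_left
      have h1 : MonomialOrder.lex.leadingTerm (finSuccEquiv k n f).leadingCoeff ∈
          Ideal.span (MonomialOrder.lex.leadingTerm '' (G : Set (MvPolynomial (Fin n) k))) := by
        rw [hG.span_leadingTerm]
        exact Ideal.subset_span ⟨_, coeff_mem_of_mem_squareCone hf hdeg _, rfl⟩
      have h2 := Ideal.mem_map_of_mem (rename (R := k) (Fin.succ : Fin n → Fin (n + 1))) h1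
      rw [Ideal.map_span] at h2
      refine Ideal.span_mono ?_ h2
      rintro _ ⟨_, ⟨g, hg, rfl⟩, rfl⟩
      refine ⟨rename Fin.succ g, ?_, lex_leadingTerm_rename_succ g⟩
      exact Finset.mem_coe.2 (Finset.mem_insert_of_mem (Finset.mem_image_of_mem _ hg))
    · obtain ⟨d, hd⟩ := Nat.exists_eq_add_of_le (not_lt.1 hdeg)
      rw [hd, pow_add, mul_assoc]
      apply Ideal.mul_mem_right
      apply Ideal.subset_span
      exact ⟨_, Finset.mem_coe.2 (Finset.mem_insert_self _ _), lex_leadingTerm_X_sq_add q⟩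

lemma finite_degree_eq (d : ℕ) : {e : Fin n →₀ ℕ | e.degree = d}.Finite := by
  refine ((Finset.finsuppAntidiag Finset.univ d : Finset (Fin n →₀ ℕ)).finite_toSet).subset ?_
  intro e he
  simpa [Finsupp.degree_eq_sum] using he

/-- Monomials generating an ideal form a Gröbner basis of it. -/
lemma GeneratedByQuadraticMonomials.exists_isGroebnerBasis {J : Ideal (MvPolynomial (Fin n) k)}
    (hJ : GeneratedByQuadraticMonomials J) :
    ∃ G : Finset (MvPolynomial (Fin n) k), (∀ g ∈ G, g.IsHomogeneous 2) ∧
      IsGroebnerBasis MonomialOrder.lex G J := by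
  classical
  obtain ⟨E, hE, rfl⟩ := hJ
  have hfin : E.Finite := (finite_degree_eq 2).subset hE
  refine ⟨hfin.toFinset.image (fun e => monomial e (1 : k)), ?_, ?_⟩
  · intro g hg
    obtain ⟨e, he, rfl⟩ := Finset.mem_image.1 hg
    exact isHomogeneous_monomial _ (hE e (by simpa using he))
  · apply isGroebnerBasis_of_leadingTerm_mem
    · intro g hg
      obtain ⟨e, he, rfl⟩ := Finset.mem_image.1 hg
      simp
    · intro g hg
      obtain ⟨e, he, rfl⟩ := Finset.mem_image.1 hg
      exact Ideal.subset_span ⟨e, by simpa using he, rfl⟩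
    · intro f hf h0
      obtain ⟨e, he, hle⟩ := mem_ideal_span_monomial_image.1 hf _
        (MonomialOrder.lex.degree_mem_support h0)
      refine Ideal.mem_of_dvd _ ?_ (Ideal.subset_span ⟨monomial e 1, ?_, rfl⟩)
      · rw [MonomialOrder.leadingTerm_monomial, MonomialOrder.leadingTerm, monomial_dvd_monomial]
        exact ⟨Or.inr hle, one_dvd _⟩
      · exact Finset.mem_coe.2 (Finset.mem_image_of_mem _ (hfin.mem_toFinset.2 he))

lemma isGQuadratic_of_isGroebnerBasis {ord : MonomialOrder.{0, 0} (Fin n)}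
    {G : Finset (MvPolynomial (Fin n) k)} {J : Ideal (MvPolynomial (Fin n) k)}
    (hG : ∀ g ∈ G, g.IsHomogeneous 2) (h : IsGroebnerBasis ord G J) : IsGQuadratic J := by
  refine ⟨AlgEquiv.refl, ord, G, fun i => isHomogeneous_X k i, hG, ?_⟩
  have : J.map (AlgEquiv.refl : MvPolynomial (Fin n) k ≃ₐ[k] MvPolynomial (Fin n) k) = J :=
    Ideal.map_id J
  rwa [this]

lemma GeneratedByQuadraticMonomials.isGQuadratic {J : Ideal (MvPolynomial (Fin n) k)}
    (hJ : GeneratedByQuadraticMonomials J) : IsGQuadratic J := by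
  obtain ⟨G, hG, h⟩ := hJ.exists_isGroebnerBasis
  exact isGQuadratic_of_isGroebnerBasis hG h

lemma exists_isGroebnerBasis_squareCone {G : Finset (MvPolynomial (Fin n) k)}
    {J₀ : Ideal (MvPolynomial (Fin n) k)} (hG₂ : ∀ g ∈ G, g.IsHomogeneous 2)
    (hG : IsGroebnerBasis MonomialOrder.lex G J₀) {q : MvPolynomial (Fin n) k}
    (hq : q.IsHomogeneous 2) :
    ∃ G' : Finset (MvPolynomial (Fin (n + 1)) k), (∀ g ∈ G', g.IsHomogeneous 2) ∧
      IsGroebnerBasis MonomialOrder.lex G' (LGQuadratic.squareCone J₀ q) := by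
  classical
  refine ⟨_, fun g hg => ?_, hG.squareCone q⟩
  rcases Finset.mem_insert.1 hg with rfl | hg
  · exact (isHomogeneous_X_pow 0 2).add hq.rename_isHomogeneous
  · obtain ⟨g, hg', rfl⟩ := Finset.mem_image.1 hg
    exact (hG₂ g hg').rename_isHomogeneous

/-! ### Lifts in adapted coordinates -/

/-- Ideals generated by variables are prime: they are the kernels of the endomorphisms that
set these variables to zero. -/
lemma isPrime_span_X_image (σ : Set (Fin n)) :
    (Ideal.span (X '' σ : Set (MvPolynomial (Fin n) k))).IsPrime := by
  classical
  set I := Ideal.span (X '' σ : Set (MvPolynomial (Fin n) k)) with hI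
  set φ : MvPolynomial (Fin n) k →ₐ[k] MvPolynomial (Fin n) k :=
    aeval (fun i => if i ∈ σ then 0 else X i) with hφ
  have h : (Ideal.Quotient.mkₐ k I).comp φ = Ideal.Quotient.mkₐ k I := by
    ext i
    by_cases hi : i ∈ σ
    · have : (X i : MvPolynomial (Fin n) k) ∈ I := Ideal.subset_span ⟨i, hi, rfl⟩
      simp [hφ, hi, Ideal.Quotient.eq_zero_iff_mem.2 this]
    · simp [hφ, hi]
  have hker : I = RingHom.ker φ := by
    apply le_antisymm
    · rw [hI, Ideal.span_le]
      rintro _ ⟨i, hi, rfl⟩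
      simp [RingHom.mem_ker, hφ, hi]
    · intro f hf
      rw [RingHom.mem_ker] at hf
      have := DFunLike.congr_fun h f
      rw [AlgHom.comp_apply, hf, map_zero] at this
      exact Ideal.Quotient.eq_zero_iff_mem.1 this.symm
  rw [hker]
  exact RingHom.ker_isPrime φ

lemma NonzerodivisorMod.of_isPrime {R : Type*} [CommRing R] {P : Ideal R} (hP : P.IsPrime) {c : R}
    (hc : c ∉ P) : NonzerodivisorMod P c :=
  fun _ hf => (hP.mem_or_mem hf).resolve_left hc

lemma nonzerodivisorMod_bot {R : Type*} [CommRing R] [IsDomain R] {c : R} (hc : c ≠ 0) :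
    NonzerodivisorMod (⊥ : Ideal R) c :=
  NonzerodivisorMod.of_isPrime Ideal.isPrime_bot (by simpa using hc)

/-- A prime element `b` is a nonzerodivisor modulo `a · P`, for `P` a prime ideal, as soon as it
does not divide `a` and does not lie in `P`. -/
lemma nonzerodivisorMod_span_singleton_mul {R : Type*} [CommRing R] [IsDomain R] {P : Ideal R}
    (hP : P.IsPrime) {a b : R} (hb : Prime b) (hba : ¬ b ∣ a) (hbP : b ∉ P) :
    NonzerodivisorMod (Ideal.span {a} * P) b := by
  intro f hf
  obtain ⟨g, hg, hgf⟩ := Ideal.mem_span_singleton_mul.1 hf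
  obtain ⟨h, rfl⟩ := (hb.dvd_or_dvd (Dvd.intro _ hgf.symm)).resolve_left hba
  refine Ideal.mem_span_singleton_mul.2 ⟨h, (hP.mem_or_mem hg).resolve_left hbP, ?_⟩
  apply mul_left_cancel₀ hb.ne_zero
  rw [← hgf]
  ring

lemma generatedByQuadraticMonomials_bot :
    GeneratedByQuadraticMonomials (⊥ : Ideal (MvPolynomial (Fin n) k)) :=
  ⟨∅, by simp, by simp⟩

lemma GeneratedByQuadraticMonomials.sup {I J : Ideal (MvPolynomial (Fin n) k)}
    (hI : GeneratedByQuadraticMonomials I) (hJ : GeneratedByQuadraticMonomials J) :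
    GeneratedByQuadraticMonomials (I ⊔ J) := by
  obtain ⟨E, hE, rfl⟩ := hI
  obtain ⟨F, hF, rfl⟩ := hJ
  refine ⟨E ∪ F, ?_, by rw [Set.image_union, Ideal.span_union]⟩
  rintro e (he | he)
  exacts [hE e he, hF e he]

lemma GeneratedByQuadraticMonomials.map_rename_succ {J : Ideal (MvPolynomial (Fin n) k)}
    (hJ : GeneratedByQuadraticMonomials J) : GeneratedByQuadraticMonomials
      (J.map (rename (R := k) (Fin.succ : Fin n → Fin (n + 1)))) := by
  obtain ⟨E, hE, rfl⟩ := hJ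
  refine ⟨Finsupp.mapDomain Fin.succ '' E, ?_, ?_⟩
  · rintro _ ⟨e, he, rfl⟩
    rw [Finsupp.degree_mapDomain, hE e he]
  · rw [Ideal.map_span, Set.image_image, Set.image_image]
    simp only [rename_monomial]

lemma map_rename_succ_span_X (σ : Set (Fin n)) :
    (Ideal.span (X '' σ : Set (MvPolynomial (Fin n) k))).map
      (rename (R := k) (Fin.succ : Fin n → Fin (n + 1))) = Ideal.span (X '' (Fin.succ '' σ)) := by
  rw [Ideal.map_span, Set.image_image, Set.image_image]
  simp only [rename_X]

lemma GeneratedByQuadraticMonomials.linearCone {J₀ : Ideal (MvPolynomial (Fin n) k)}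
    (hJ : GeneratedByQuadraticMonomials J₀) (σ : Set (Fin n)) :
    GeneratedByQuadraticMonomials (linearCone J₀ (Ideal.span (X '' σ))) := by
  refine hJ.map_rename_succ.sup
    ⟨(fun i => Finsupp.single 0 1 + Finsupp.single i 1) '' (Fin.succ '' σ), ?_, ?_⟩
  · rintro _ ⟨i, -, rfl⟩
    simp [Finsupp.degree_single]
  · rw [map_rename_succ_span_X, Ideal.span_mul_span', Set.image_image, Set.singleton_mul,
      Set.image_image]
    congr! 2
    ext1 i
    simp [X, monomial_mul]

lemma linearCone_sup_map (I₀ M I₁ : Ideal (MvPolynomial (Fin n) k)) :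
    linearCone I₀ M ⊔ I₁.map (rename (R := k) (Fin.succ : Fin n → Fin (n + 1))) =
      linearCone (I₀ ⊔ I₁) M := by
  rw [linearCone, linearCone, Ideal.map_sup, sup_right_comm]

lemma squareCone_sup_map (I₀ I₁ : Ideal (MvPolynomial (Fin n) k)) (q : MvPolynomial (Fin n) k) :
    squareCone I₀ q ⊔ I₁.map (rename (R := k) (Fin.succ : Fin n → Fin (n + 1))) =
      squareCone (I₀ ⊔ I₁) q := by
  rw [squareCone, squareCone, Ideal.map_sup, sup_right_comm]

lemma span_rename_succ (q : MvPolynomial (Fin n) k) :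
    Ideal.span {rename (Fin.succ : Fin n → Fin (n + 1)) q} =
      (Ideal.span {q}).map (rename (R := k) (Fin.succ : Fin n → Fin (n + 1))) := by
  rw [Ideal.map_span, Set.image_singleton]

lemma span_rename_succ_mul (a : MvPolynomial (Fin n) k) (L : Ideal (MvPolynomial (Fin n) k)) :
    Ideal.span {rename (Fin.succ : Fin n → Fin (n + 1)) a} *
        L.map (rename (R := k) (Fin.succ : Fin n → Fin (n + 1))) =
      (Ideal.span {a} * L).map (rename (R := k) (Fin.succ : Fin n → Fin (n + 1))) := by
  rw [Ideal.map_mul, span_rename_succ]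

/-- In suitable coordinates `(a)L + (b)M` lifts to the monomial ideal `(A)L + (B)M`, where `A` and
`B` are new variables. -/
lemma exists_monomial_lift {σ τ : Set (Fin n)} {a b : MvPolynomial (Fin n) k}
    (ha : a.IsHomogeneous 1) (hb : b.IsHomogeneous 1) (hb' : Prime b)
    (haM : a ∉ Ideal.span (X '' τ : Set (MvPolynomial (Fin n) k)))
    (hbL : b ∉ Ideal.span (X '' σ : Set (MvPolynomial (Fin n) k))) (hba : ¬ b ∣ a)
    (hI : Ideal.span {a} * Ideal.span (X '' σ) ⊔ Ideal.span {b} * Ideal.span (X '' τ) ≠ ⊤) :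
    ∃ (m : ℕ) (J : Ideal (MvPolynomial (Fin m) k)), GeneratedByQuadraticMonomials J ∧
      IsQuotientByRegularLinearForms J
        (Ideal.span {a} * Ideal.span (X '' σ) ⊔ Ideal.span {b} * Ideal.span (X '' τ)) := by
  have ha0 : a ≠ 0 := fun h => hba (h ▸ dvd_zero b)
  have haM' := NonzerodivisorMod.of_isPrime (isPrime_span_X_image τ) haM
  have hbaL := nonzerodivisorMod_span_singleton_mul (isPrime_span_X_image σ) hb' hba hbL
  have h₁ := isRegularSection_linearCone
    ((Ideal.span (X '' σ : Set (MvPolynomial (Fin n) k))).map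
      (rename (R := k) (Fin.succ : Fin n → Fin (n + 1))))
    (nonzerodivisorMod_linearCone (nonzerodivisorMod_bot ha0) (by rwa [bot_sup_eq]))
  rw [span_rename_succ_mul, linearCone_sup_map, bot_sup_eq] at h₁
  have h₂ := isRegularSection_linearCone (Ideal.span (X '' τ)) hbaL
  refine ⟨n + 2, _, ?_, h₁.isQuotientByRegularLinearForms h₂ ha hb hI⟩
  rw [map_rename_succ_span_X]
  exact (generatedByQuadraticMonomials_bot.linearCone τ).linearCone _

/-- In suitable coordinates `(q) + (b)M` lifts to `(A² + q) + (B)M`, where `A` and `B` are new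
variables. -/
lemma isLGQuadratic_quadric_sup_linear {τ : Set (Fin n)} {q b : MvPolynomial (Fin n) k}
    (hq : q.IsHomogeneous 2) (hb : b.IsHomogeneous 1) (hq0 : q ≠ 0)
    (hqM : q ∉ Ideal.span (X '' τ : Set (MvPolynomial (Fin n) k)))
    (hbq : NonzerodivisorMod (Ideal.span {q}) b)
    (hI : Ideal.span {q} ⊔ Ideal.span {b} * Ideal.span (X '' τ) ≠ ⊤) :
    IsLGQuadratic (Ideal.span {q} ⊔ Ideal.span {b} * Ideal.span (X '' τ)) := by
  have hqM' := NonzerodivisorMod.of_isPrime (isPrime_span_X_image τ) hqM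
  have h₁ := isRegularSection_squareCone
    (nonzerodivisorMod_linearCone (nonzerodivisorMod_bot hq0)
      (L := Ideal.span (X '' τ : Set (MvPolynomial (Fin n) k))) (by rwa [bot_sup_eq]))
  rw [span_rename_succ, linearCone_sup_map, bot_sup_eq,
    ← map_zero (rename (R := k) (Fin.succ : Fin n → Fin (n + 1)))] at h₁
  have h₂ := isRegularSection_linearCone (Ideal.span (X '' τ)) hbq
  refine ⟨n + 2, _, ?_, h₁.isQuotientByRegularLinearForms h₂ (isHomogeneous_zero _ _ _) hb hI⟩
  obtain ⟨G, hG₂, hG⟩ :=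
    ((generatedByQuadraticMonomials_bot (k := k)).linearCone τ).exists_isGroebnerBasis
  obtain ⟨G', hG'₂, hG'⟩ := exists_isGroebnerBasis_squareCone hG₂ hG hq.rename_isHomogeneous
  exact isGQuadratic_of_isGroebnerBasis hG'₂ hG'

/-- A complete intersection `(q₁, q₂)` of quadrics lifts to `(A² + q₁, B² + q₂)`, where `A` and `B`
are new variables. -/
lemma isLGQuadratic_quadric_sup_quadric {q₁ q₂ : MvPolynomial (Fin n) k}
    (hq₁ : q₁.IsHomogeneous 2) (hq₂ : q₂.IsHomogeneous 2) (hq0 : q₁ ≠ 0)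
    (hreg : NonzerodivisorMod (Ideal.span {q₁}) q₂)
    (hI : Ideal.span {q₁} ⊔ Ideal.span {q₂} ≠ ⊤) :
    IsLGQuadratic (Ideal.span {q₁} ⊔ Ideal.span {q₂}) := by
  have h₁ := isRegularSection_squareCone
    (nonzerodivisorMod_squareCone q₂ (nonzerodivisorMod_bot hq0))
  rw [span_rename_succ, squareCone_sup_map, bot_sup_eq,
    ← map_zero (rename (R := k) (Fin.succ : Fin n → Fin (n + 1)))] at h₁
  have h₂ := isRegularSection_squareCone hreg
  refine ⟨n + 2, _, ?_, h₁.isQuotientByRegularLinearForms h₂ (isHomogeneous_zero _ _ _)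
    (isHomogeneous_zero _ _ _) hI⟩
  obtain ⟨G, hG₂, hG⟩ :=
    (generatedByQuadraticMonomials_bot (k := k) (n := n)).exists_isGroebnerBasis
  obtain ⟨G', hG'₂, hG'⟩ := exists_isGroebnerBasis_squareCone hG₂ hG hq₂
  obtain ⟨G'', hG''₂, hG''⟩ := exists_isGroebnerBasis_squareCone hG'₂ hG' hq₁.rename_isHomogeneous
  exact isGQuadratic_of_isGroebnerBasis hG''₂ hG''

/-! ### Linear changes of coordinates -/

lemma isHomogeneous_algHom {φ : MvPolynomial (Fin n) k →ₐ[k] MvPolynomial (Fin n) k}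
    (hφ : ∀ i, (φ (X i)).IsHomogeneous 1) {f : MvPolynomial (Fin n) k} {d : ℕ}
    (hf : f.IsHomogeneous d) : (φ f).IsHomogeneous d := by
  rw [aeval_unique φ, ← one_mul d]
  exact hf.aeval _ hφ

/-- A linear change of coordinates of the quotient only changes the isomorphism, not the lift. -/
lemma IsQuotientByRegularLinearForms.of_map {m : ℕ} {J : Ideal (MvPolynomial (Fin m) k)}
    {I : Ideal (MvPolynomial (Fin n) k)} (ψ : MvPolynomial (Fin n) k ≃ₐ[k] MvPolynomial (Fin n) k)
    (hψ : ∀ i, (ψ.symm (X i)).IsHomogeneous 1)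
    (h : IsQuotientByRegularLinearForms J (I.map ψ)) : IsQuotientByRegularLinearForms J I := by
  obtain ⟨l, hl, hreg, e, he⟩ := h
  refine ⟨l, hl, hreg, e.trans (Ideal.quotientEquivAlg I (I.map ψ) ψ rfl).symm, fun i => ?_⟩
  obtain ⟨f, hf, hfe⟩ := he i
  refine ⟨ψ.symm f, isHomogeneous_algHom (φ := (ψ.symm : _ →ₐ[k] _)) hψ hf, ?_⟩
  rw [AlgEquiv.trans_apply, hfe, AlgEquiv.symm_apply_eq]
  exact congrArg (Ideal.Quotient.mk (I.map ψ)) (ψ.apply_symm_apply f).symm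

lemma IsLGQuadratic.of_map {I : Ideal (MvPolynomial (Fin n) k)}
    (ψ : MvPolynomial (Fin n) k ≃ₐ[k] MvPolynomial (Fin n) k)
    (hψ : ∀ i, (ψ.symm (X i)).IsHomogeneous 1) (h : IsLGQuadratic (I.map ψ)) : IsLGQuadratic I := by
  obtain ⟨m, J, hJ, hJI⟩ := h
  exact ⟨m, J, hJ, hJI.of_map ψ hψ⟩

/-- Two independent subspaces are spanned by parts of a common basis. -/
lemma exists_basis_adapted {K E : Type*} [Field K] [AddCommGroup E] [Module K E] {ι : Type*}
    (b₀ : Module.Basis ι K E) {V W : Submodule K E} (h : Disjoint V W) :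
    ∃ (b : Module.Basis ι K E) (σ τ : Set ι), V = Submodule.span K (b '' σ) ∧
      W = Submodule.span K (b '' τ) := by
  obtain ⟨s, hsV, hs, hsi⟩ := exists_linearIndependent K (V : Set E)
  obtain ⟨t, htW, ht, hti⟩ := exists_linearIndependent K (W : Set E)
  rw [Submodule.span_eq] at hs ht
  have hli : LinearIndepOn K id (s ∪ t) :=
    LinearIndepOn.id_union hsi hti (by rwa [hs, ht])
  set b₁ := Module.Basis.extend hli with hb₁
  set b := b₁.reindex (b₁.indexEquiv b₀) with hb
  have hrange : Set.range b = hli.extend (Set.subset_univ _) := by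
    rw [hb, Module.Basis.range_reindex, hb₁, Module.Basis.range_extend]
  have himage : ∀ u ⊆ s ∪ t, b '' (b ⁻¹' u) = u := by
    intro u hu
    rw [Set.image_preimage_eq_inter_range, hrange]
    exact Set.inter_eq_left.2 (hu.trans (hli.subset_extend _))
  refine ⟨b, b ⁻¹' s, b ⁻¹' t, ?_, ?_⟩
  · rw [himage s Set.subset_union_left, hs]
  · rw [himage t Set.subset_union_right, ht]

/-- The ideal generated by a space of linear forms. -/
noncomputable def idealOfLinearForms (V : Submodule k (homogeneousSubmodule (Fin n) k 1)) :
    Ideal (MvPolynomial (Fin n) k) :=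
  Ideal.span ((↑) '' (V : Set (homogeneousSubmodule (Fin n) k 1)))

/-- The variables as a basis of the space of linear forms. -/
noncomputable def basisX : Module.Basis (Fin n) k (homogeneousSubmodule (Fin n) k 1) :=
  (Module.Basis.span (linearIndependent_X (Fin n) k)).map
    (LinearEquiv.ofEq _ _ (homogeneousSubmodule_one_eq_span_X (σ := Fin n) (R := k)).symm)

lemma coe_basisX (i : Fin n) : ((basisX (k := k) i : _) : MvPolynomial (Fin n) k) = X i := by
  simp [basisX, Module.Basis.span_apply]

/-- The algebra endomorphism extending an endomorphism of the space of linear forms. -/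
noncomputable def linearSubstitution
    (T : homogeneousSubmodule (Fin n) k 1 →ₗ[k] homogeneousSubmodule (Fin n) k 1) :
    MvPolynomial (Fin n) k →ₐ[k] MvPolynomial (Fin n) k :=
  aeval (fun i => (T (basisX i) : MvPolynomial (Fin n) k))

lemma linearSubstitution_apply
    (T : homogeneousSubmodule (Fin n) k 1 →ₗ[k] homogeneousSubmodule (Fin n) k 1)
    (l : homogeneousSubmodule (Fin n) k 1) : linearSubstitution T l = T l := by
  have : (linearSubstitution T).toLinearMap ∘ₗ Submodule.subtype _ = Submodule.subtype _ ∘ₗ T := by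
    apply basisX.ext
    intro i
    simp [coe_basisX, linearSubstitution]
  exact LinearMap.congr_fun this l

lemma linearSubstitution_comp
    (S T : homogeneousSubmodule (Fin n) k 1 →ₗ[k] homogeneousSubmodule (Fin n) k 1)
    (h : S ∘ₗ T = LinearMap.id) :
    (linearSubstitution S).comp (linearSubstitution T) = AlgHom.id k _ := by
  ext1 i
  rw [AlgHom.comp_apply, ← coe_basisX, linearSubstitution_apply, linearSubstitution_apply,
    ← LinearMap.comp_apply, h]
  rfl

/-- The linear change of coordinates given by an automorphism of the space of linear forms. -/
noncomputable def linearCoordinateChange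
    (T : homogeneousSubmodule (Fin n) k 1 ≃ₗ[k] homogeneousSubmodule (Fin n) k 1) :
    MvPolynomial (Fin n) k ≃ₐ[k] MvPolynomial (Fin n) k :=
  AlgEquiv.ofAlgHom (linearSubstitution T) (linearSubstitution T.symm)
    (linearSubstitution_comp _ _ (by ext1; simp))
    (linearSubstitution_comp _ _ (by ext1; simp))

lemma idealOfLinearForms_span (s : Set (homogeneousSubmodule (Fin n) k 1)) :
    idealOfLinearForms (Submodule.span k s) = Ideal.span ((↑) '' s) := by
  apply le_antisymm
  · rw [idealOfLinearForms, Ideal.span_le]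
    rintro _ ⟨l, hl, rfl⟩
    have : Submodule.span k s ≤
        ((Ideal.span ((↑) '' s : Set (MvPolynomial (Fin n) k))).restrictScalars k).comap
          (Submodule.subtype _) :=
      Submodule.span_le.2 fun x hx => Ideal.subset_span ⟨x, hx, rfl⟩
    exact this hl
  · exact Ideal.span_mono (Set.image_mono Submodule.subset_span)

/-- Two independent spaces of linear forms are spanned by variables after a linear change of
coordinates. -/
lemma exists_linearCoordinateChange {V W : Submodule k (homogeneousSubmodule (Fin n) k 1)}
    (h : Disjoint V W) :
    ∃ (ψ : MvPolynomial (Fin n) k ≃ₐ[k] MvPolynomial (Fin n) k) (σ τ : Set (Fin n)),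
      (∀ i, (ψ (X i)).IsHomogeneous 1) ∧ (∀ i, (ψ.symm (X i)).IsHomogeneous 1) ∧
      (idealOfLinearForms V).map ψ = Ideal.span (X '' σ) ∧
      (idealOfLinearForms W).map ψ = Ideal.span (X '' τ) := by
  obtain ⟨b, σ, τ, rfl, rfl⟩ := exists_basis_adapted basisX h
  have key : ∀ ρ : Set (Fin n), (idealOfLinearForms (Submodule.span k (b '' ρ))).map
      (linearCoordinateChange (b.equiv basisX (Equiv.refl _))) = Ideal.span (X '' ρ) := by
    intro ρ
    rw [idealOfLinearForms_span, Ideal.map_span, Set.image_image, Set.image_image]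
    refine congrArg Ideal.span (Set.image_congr fun i _ => ?_)
    refine (linearSubstitution_apply _ (b i)).trans ?_
    simp [coe_basisX]
  refine ⟨linearCoordinateChange (b.equiv basisX (Equiv.refl _)), σ, τ, fun i => ?_, fun i => ?_,
    key σ, key τ⟩
  · refine (isHomogeneous_algHom (φ := linearSubstitution _) (fun j => ?_) (isHomogeneous_X k i))
    rw [linearSubstitution, aeval_X]
    exact SetLike.coe_mem (p := homogeneousSubmodule (Fin n) k 1) _
  · refine (isHomogeneous_algHom (φ := linearSubstitution _) (fun j => ?_) (isHomogeneous_X k i))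
    rw [linearSubstitution, aeval_X]
    exact SetLike.coe_mem (p := homogeneousSubmodule (Fin n) k 1) _

/-! ### Height one ideals generated by quadrics -/

/-- The homomorphism `X i ↦ X i * t`, whose coefficient at `t ^ d` is the homogeneous component of
degree `d`. -/
noncomputable def homogenizeGrading :
    MvPolynomial (Fin n) k →ₐ[k] Polynomial (MvPolynomial (Fin n) k) :=
  aeval (fun i => Polynomial.C (X i) * Polynomial.X)

lemma homogenizeGrading_monomial (e : Fin n →₀ ℕ) (c : k) :
    homogenizeGrading (monomial e c) = Polynomial.C (monomial e c) * Polynomial.X ^ e.degree := by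
  rw [homogenizeGrading, aeval_monomial, monomial_eq, Finsupp.degree, Finsupp.prod, Finsupp.prod]
  simp only [mul_pow, Finset.prod_mul_distrib, map_mul, map_prod, map_pow,
    Finset.prod_pow_eq_pow_sum, mul_assoc]
  rfl

lemma coeff_homogenizeGrading (f : MvPolynomial (Fin n) k) (d : ℕ) :
    (homogenizeGrading f).coeff d = homogeneousComponent d f := by
  induction f using MvPolynomial.induction_on' with
  | monomial e c =>
    rw [homogenizeGrading_monomial, Polynomial.coeff_C_mul_X_pow,
      homogeneousComponent_of_mem (isHomogeneous_monomial c rfl)]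
  | add p q hp hq => rw [map_add, map_add, Polynomial.coeff_add, hp, hq]

lemma isHomogeneous_of_natTrailingDegree_eq {f : MvPolynomial (Fin n) k}
    (h : (homogenizeGrading f).natTrailingDegree = (homogenizeGrading f).natDegree) :
    f.IsHomogeneous (homogenizeGrading f).natDegree := by
  intro e he
  by_contra hne
  have hd : e.degree = Finsupp.weight 1 e := by rw [Finsupp.degree_eq_weight_one]; rfl
  rw [← hd] at hne
  have h1 : coeff e (homogeneousComponent e.degree f) ≠ 0 := by
    rwa [coeff_homogeneousComponent, if_pos rfl]
  have h2 : (homogenizeGrading f).coeff e.degree ≠ 0 := by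
    rw [coeff_homogenizeGrading]
    rintro h0
    simp [h0] at h1
  exact hne (le_antisymm (Polynomial.le_natDegree_of_ne_zero h2)
    (h ▸ Polynomial.natTrailingDegree_le_of_ne_zero h2))

/-- Factors of a nonzero homogeneous polynomial are homogeneous: the lowest and the highest degree
occurring are both additive, and they agree on the product. -/
lemma exists_isHomogeneous_of_mul {f g : MvPolynomial (Fin n) k} {d : ℕ} (hfg : f * g ≠ 0)
    (h : (f * g).IsHomogeneous d) :
    ∃ i j, f.IsHomogeneous i ∧ g.IsHomogeneous j ∧ i + j = d := by
  have hH : homogenizeGrading (f * g) = Polynomial.C (f * g) * Polynomial.X ^ d := by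
    ext1 i
    rw [coeff_homogenizeGrading, Polynomial.coeff_C_mul_X_pow, homogeneousComponent_of_mem h]
  have hne : ∀ p : MvPolynomial (Fin n) k, p ≠ 0 → homogenizeGrading p ≠ 0 := by
    intro p hp h0
    apply hp
    rw [← sum_homogeneousComponent p]
    exact Finset.sum_eq_zero fun i _ => by rw [← coeff_homogenizeGrading, h0, Polynomial.coeff_zero]
  have hf := hne f (left_ne_zero_of_mul hfg)
  have hg := hne g (right_ne_zero_of_mul hfg)
  rw [map_mul] at hH
  have h1 := congrArg Polynomial.natDegree hH
  have h2 := congrArg Polynomial.natTrailingDegree hH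
  rw [Polynomial.natDegree_mul hf hg, Polynomial.natDegree_C_mul_X_pow _ _ hfg] at h1
  rw [Polynomial.natTrailingDegree_mul hf hg, Polynomial.C_mul_X_pow_eq_monomial,
    Polynomial.natTrailingDegree_monomial hfg] at h2
  have h3 := Polynomial.natTrailingDegree_le_natDegree (homogenizeGrading f)
  have h4 := Polynomial.natTrailingDegree_le_natDegree (homogenizeGrading g)
  exact ⟨_, _, isHomogeneous_of_natTrailingDegree_eq (by omega),
    isHomogeneous_of_natTrailingDegree_eq (by omega), h1⟩

lemma isUnit_of_isHomogeneous_zero {f : MvPolynomial (Fin n) k} (hf : f.IsHomogeneous 0)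
    (h0 : f ≠ 0) : IsUnit f := by
  rw [totalDegree_eq_zero_iff_eq_C.1 ((totalDegree_zero_iff_isHomogeneous _).2 hf)] at h0 ⊢
  exact (isUnit_iff_ne_zero.2 fun h => h0 (by rw [h, C_0])).map C

lemma mem_idealOfVars_pow {f : MvPolynomial (Fin n) k} {d e : ℕ} (hf : f.IsHomogeneous d)
    (h : e ≤ d) : f ∈ idealOfVars (Fin n) k ^ e := by
  rw [mem_pow_idealOfVars_iff']
  exact fun x hx => hf.coeff_eq_zero (by omega)

lemma eq_zero_of_mem_idealOfVars_pow {f : MvPolynomial (Fin n) k} {d e : ℕ}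
    (hf : f.IsHomogeneous d) (h : d < e) (hmem : f ∈ idealOfVars (Fin n) k ^ e) : f = 0 := by
  rw [mem_pow_idealOfVars_iff'] at hmem
  ext x
  rw [coeff_zero]
  by_cases hx : x.degree = d
  · exact hmem x (by omega)
  · exact hf.coeff_eq_zero hx

lemma not_isUnit_of_isHomogeneous {f : MvPolynomial (Fin n) k} {d : ℕ} (hf : f.IsHomogeneous d)
    (hd : d ≠ 0) : ¬ IsUnit f := by
  intro hu
  have h1 : (1 : MvPolynomial (Fin n) k) ∈ idealOfVars (Fin n) k ^ 1 := by
    obtain ⟨g, hg⟩ := hu.exists_right_inv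
    rw [← hg]
    exact Ideal.mul_mem_right _ _ (mem_idealOfVars_pow hf (by omega))
  exact one_ne_zero (eq_zero_of_mem_idealOfVars_pow (isHomogeneous_one (Fin n) k) one_pos h1)

lemma prime_of_isHomogeneous_one {a : MvPolynomial (Fin n) k} (ha : a.IsHomogeneous 1)
    (h0 : a ≠ 0) : Prime a := by
  apply Irreducible.prime
  refine ⟨not_isUnit_of_isHomogeneous ha one_ne_zero, fun f g hfg => ?_⟩
  subst hfg
  obtain ⟨i, j, hi, hj, hij⟩ := exists_isHomogeneous_of_mul h0 ha
  have : i = 0 ∨ j = 0 := by omega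
  rcases this with rfl | rfl
  · exact Or.inl (isUnit_of_isHomogeneous_zero hi (left_ne_zero_of_mul h0))
  · exact Or.inr (isUnit_of_isHomogeneous_zero hj (right_ne_zero_of_mul h0))

lemma GeneratedByQuadrics.le_idealOfVars {I : Ideal (MvPolynomial (Fin n) k)}
    (hI : GeneratedByQuadrics I) : I ≤ idealOfVars (Fin n) k := by
  obtain ⟨Q, hQ, rfl⟩ := hI
  refine Ideal.span_le.2 fun q hq => ?_
  simpa using mem_idealOfVars_pow (hQ q hq) one_le_two

lemma idealOfVars_ne_top : idealOfVars (Fin n) k ≠ ⊤ := by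
  intro h
  have h1 : (1 : MvPolynomial (Fin n) k) ∈ idealOfVars (Fin n) k ^ 1 := by simp [h]
  exact one_ne_zero (eq_zero_of_mem_idealOfVars_pow (isHomogeneous_one (Fin n) k) one_pos h1)

/-- A height one ideal generated by quadrics lies in a principal prime `(p)` with `p` homogeneous.
If `p` is a quadric it generates the ideal; if `p` is a linear form, it is a common factor. -/
lemma GeneratedByQuadrics.eq_span_or_eq_mul {I : Ideal (MvPolynomial (Fin n) k)}
    (hI : GeneratedByQuadrics I) (hht : I.height = 1) :
    (∃ q : MvPolynomial (Fin n) k, q.IsHomogeneous 2 ∧ Irreducible q ∧ I = Ideal.span {q}) ∨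
    ∃ (a : MvPolynomial (Fin n) k) (V : Submodule k (homogeneousSubmodule (Fin n) k 1)),
      a.IsHomogeneous 1 ∧ a ≠ 0 ∧ V ≠ ⊥ ∧ I = Ideal.span {a} * idealOfLinearForms V := by
  have hbot : I ≠ ⊥ := Ideal.ne_bot_of_height_eq_one hht
  obtain ⟨P, hP, hIP, hPht⟩ := Ideal.exists_isPrime_height_eq (n := 1) hht
  obtain ⟨p, hpP, hp⟩ := hP.exists_mem_prime_of_ne_bot
    (Ideal.ne_bot_of_height_eq_one hPht)
  have hPp : P = Ideal.span {p} := Ideal.eq_span_singleton_of_height_eq_one hPht hpP hp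
  obtain ⟨Q, hQ, rfl⟩ := hI
  have hdvd : ∀ q ∈ Q, p ∣ q := fun q hq =>
    Ideal.mem_span_singleton.1 (hPp ▸ hIP (Ideal.subset_span hq))
  obtain ⟨q₀, hq₀, hq₀0⟩ : ∃ q ∈ Q, q ≠ 0 := by
    by_contra! h
    exact hbot (Ideal.span_eq_bot.2 h)
  obtain ⟨r, hr⟩ := hdvd q₀ hq₀
  rw [hr] at hq₀0
  obtain ⟨i, j, hi, hj, hij⟩ := exists_isHomogeneous_of_mul hq₀0 (hr ▸ hQ q₀ hq₀)
  have hi0 : i ≠ 0 := by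
    rintro rfl
    exact hp.not_isUnit (isUnit_of_isHomogeneous_zero hi hp.ne_zero)
  have hi12 : i = 1 ∨ i = 2 := by omega
  have hcof : ∀ q ∈ Q, ∃ l : MvPolynomial (Fin n) k, l.IsHomogeneous (2 - i) ∧ q = p * l := by
    intro q hq
    obtain ⟨l, rfl⟩ := hdvd q hq
    by_cases h0 : p * l = 0
    · exact ⟨0, isHomogeneous_zero _ _ _, by rw [h0, mul_zero]⟩
    · obtain ⟨i', j', hi', hj', hij'⟩ := exists_isHomogeneous_of_mul h0 (hQ _ hq)
      obtain rfl := hi.inj_right hi' hp.ne_zero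
      refine ⟨l, ?_, rfl⟩
      rwa [← hij', Nat.add_sub_cancel_left]
  rcases hi12 with rfl | rfl
  · right
    refine ⟨p, {
      carrier := {l | p * (l : MvPolynomial (Fin n) k) ∈ Ideal.span Q}
      add_mem' := fun {x y} hx hy => by
        simpa [mul_add] using Ideal.add_mem _ hx hy
      zero_mem' := by simp
      smul_mem' := fun c x hx => by
        have hx' : p * (x : MvPolynomial (Fin n) k) ∈ Ideal.span Q := hx
        simpa [smul_eq_C_mul, mul_left_comm] using Ideal.mul_mem_left _ (C c) hx' },
      hi, hp.ne_zero, ?_, ?_⟩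
    · intro hV
      obtain ⟨l, hl, hql⟩ := hcof q₀ hq₀
      have hmem : (⟨l, hl⟩ : homogeneousSubmodule (Fin n) k 1) ∈
          (⊥ : Submodule k (homogeneousSubmodule (Fin n) k 1)) := by
        rw [← hV]
        change p * l ∈ Ideal.span Q
        exact hql ▸ Ideal.subset_span hq₀
      have : l = 0 := congrArg Subtype.val ((Submodule.mem_bot k).1 hmem)
      rw [← hr, hql, this, mul_zero] at hq₀0
      exact hq₀0 rfl
    · apply le_antisymm
      · refine Ideal.span_le.2 fun q hq => ?_
        obtain ⟨l, hl, rfl⟩ := hcof q hq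
        exact Ideal.mul_mem_mul (Ideal.mem_span_singleton_self _)
          (Ideal.subset_span ⟨⟨l, hl⟩, Ideal.subset_span hq, rfl⟩)
      · rw [idealOfLinearForms, Ideal.span_mul_span', Ideal.span_le, Set.singleton_mul]
        rintro _ ⟨_, ⟨l, hl, rfl⟩, rfl⟩
        exact hl
  · left
    refine ⟨p, hi, hp.irreducible, le_antisymm (hPp ▸ hIP) ?_⟩
    rw [Ideal.span_singleton_le_iff_mem]
    obtain ⟨u, hu⟩ := isUnit_of_isHomogeneous_zero (by rwa [show j = 0 by omega] at hj)
      (right_ne_zero_of_mul hq₀0)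
    have : p = q₀ * ↑u⁻¹ := by rw [hr, ← hu, mul_assoc, Units.mul_inv, mul_one]
    rw [this]
    exact Ideal.mul_mem_right _ _ (Ideal.subset_span hq₀)

/-! ### Consequences of transversality -/

lemma idealOfLinearForms_le (V : Submodule k (homogeneousSubmodule (Fin n) k 1)) :
    idealOfLinearForms V ≤ idealOfVars (Fin n) k := by
  refine Ideal.span_le.2 ?_
  rintro _ ⟨l, -, rfl⟩
  simpa using mem_idealOfVars_pow l.2 le_rfl

lemma mem_idealOfLinearForms {V : Submodule k (homogeneousSubmodule (Fin n) k 1)}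
    {l : homogeneousSubmodule (Fin n) k 1} (hl : l ∈ V) :
    (l : MvPolynomial (Fin n) k) ∈ idealOfLinearForms V :=
  Ideal.subset_span ⟨l, hl, rfl⟩

lemma Transversal.symm {R : Type*} [CommRing R] {I J : Ideal R} (h : Transversal I J) :
    Transversal J I := by
  rw [Transversal, inf_comm, h, mul_comm]

/-- For transversal `aL` and `bM`, a multiple `abx` lying in both ideals has `x ∈ LM`. -/
lemma Transversal.mem_mul {R : Type*} [CommRing R] [IsDomain R] {a b x : R} {L M : Ideal R}
    (h : Transversal (Ideal.span {a} * L) (Ideal.span {b} * M)) (ha : a ≠ 0) (hb : b ≠ 0)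
    (h₁ : b * x ∈ L) (h₂ : a * x ∈ M) : x ∈ L * M := by
  have hmem : a * b * x ∈ Ideal.span {a} * L ⊓ Ideal.span {b} * M := by
    refine ⟨Ideal.mem_span_singleton_mul.2 ⟨_, h₁, (mul_assoc _ _ _).symm⟩,
      Ideal.mem_span_singleton_mul.2 ⟨_, h₂, by ring⟩⟩
  rw [h, mul_mul_mul_comm, Ideal.span_singleton_mul_span_singleton] at hmem
  obtain ⟨z, hz, hzx⟩ := Ideal.mem_span_singleton_mul.1 hmem
  rwa [← mul_left_cancel₀ (mul_ne_zero ha hb) hzx]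

lemma eq_zero_of_mem_mul {V W : Submodule k (homogeneousSubmodule (Fin n) k 1)}
    {l : homogeneousSubmodule (Fin n) k 1}
    (h : (l : MvPolynomial (Fin n) k) ∈ idealOfLinearForms V * idealOfLinearForms W) : l = 0 := by
  have h2 : (l : MvPolynomial (Fin n) k) ∈ idealOfVars (Fin n) k ^ 2 := by
    rw [sq]
    exact Ideal.mul_mono (idealOfLinearForms_le V) (idealOfLinearForms_le W) h
  exact Subtype.ext (eq_zero_of_mem_idealOfVars_pow l.2 one_lt_two h2)

section Linear

variable {a b : MvPolynomial (Fin n) k} {V W : Submodule k (homogeneousSubmodule (Fin n) k 1)}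

lemma Transversal.disjoint (h : Transversal (Ideal.span {a} * idealOfLinearForms V)
    (Ideal.span {b} * idealOfLinearForms W)) (ha : a ≠ 0) (hb : b ≠ 0) : Disjoint V W := by
  rw [Submodule.disjoint_def]
  intro l hV hW
  exact eq_zero_of_mem_mul (h.mem_mul ha hb (Ideal.mul_mem_left _ _ (mem_idealOfLinearForms hV))
    (Ideal.mul_mem_left _ _ (mem_idealOfLinearForms hW)))

lemma Transversal.notMem_of_ne_bot (h : Transversal (Ideal.span {a} * idealOfLinearForms V)
    (Ideal.span {b} * idealOfLinearForms W)) (ha : a ≠ 0) (hb : b ≠ 0) (hV : V ≠ ⊥) :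
    a ∉ idealOfLinearForms W := by
  intro haW
  obtain ⟨l, hl, hl0⟩ := V.exists_mem_ne_zero_of_ne_bot hV
  exact hl0 (eq_zero_of_mem_mul (h.mem_mul ha hb
    (Ideal.mul_mem_left _ _ (mem_idealOfLinearForms hl)) (Ideal.mul_mem_right _ _ haW)))

/-- If `a = bc`, then for `l ∈ V` and `w ∈ W` the cubic form `alw` lies in both ideals, hence in
`ab · LM`, which contains no nonzero form of degree less than four. -/
lemma Transversal.not_dvd (h : Transversal (Ideal.span {a} * idealOfLinearForms V)
    (Ideal.span {b} * idealOfLinearForms W)) (hb₁ : b.IsHomogeneous 1) (ha : a ≠ 0)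
    (hV : V ≠ ⊥) (hW : W ≠ ⊥) : ¬ b ∣ a := by
  rintro ⟨c, rfl⟩
  obtain ⟨l, hl, hl0⟩ := V.exists_mem_ne_zero_of_ne_bot hV
  obtain ⟨w, hw, hw0⟩ := W.exists_mem_ne_zero_of_ne_bot hW
  have hmem : b * c * (l * w) ∈ Ideal.span {b * c} * idealOfLinearForms V ⊓
      Ideal.span {b} * idealOfLinearForms W := by
    refine ⟨Ideal.mem_span_singleton_mul.2
        ⟨_, Ideal.mul_mem_right _ _ (mem_idealOfLinearForms hl), rfl⟩,
      Ideal.mem_span_singleton_mul.2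
        ⟨c * l * w, Ideal.mul_mem_left _ _ (mem_idealOfLinearForms hw), by ring⟩⟩
  rw [h, mul_assoc, ← mul_assoc (idealOfLinearForms V), mul_comm (idealOfLinearForms V),
    mul_assoc] at hmem
  obtain ⟨z, hz, hzlw⟩ := Ideal.mem_span_singleton_mul.1 hmem
  rw [mul_left_cancel₀ ha hzlw] at hz
  have h3 : (l * w : MvPolynomial (Fin n) k) ∈ idealOfVars (Fin n) k ^ 3 := by
    have hb' : Ideal.span {b} ≤ idealOfVars (Fin n) k := by
      rw [Ideal.span_singleton_le_iff_mem]
      simpa using mem_idealOfVars_pow hb₁ le_rfl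
    rw [pow_succ' _ 2, sq]
    exact Ideal.mul_mono hb' (Ideal.mul_mono (idealOfLinearForms_le V) (idealOfLinearForms_le W)) hz
  have h0 := eq_zero_of_mem_idealOfVars_pow (l.2.mul w.2) (by norm_num) h3
  rcases mul_eq_zero.1 h0 with h0 | h0
  · exact hl0 (Subtype.ext h0)
  · exact hw0 (Subtype.ext h0)

end Linear

lemma dvd_of_map_dvd {ψ : MvPolynomial (Fin n) k ≃ₐ[k] MvPolynomial (Fin n) k}
    {a b : MvPolynomial (Fin n) k} (h : ψ b ∣ ψ a) : b ∣ a :=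
  (map_dvd_iff ψ).1 h

lemma mem_of_map_mem {ψ : MvPolynomial (Fin n) k ≃ₐ[k] MvPolynomial (Fin n) k}
    {I : Ideal (MvPolynomial (Fin n) k)} {a : MvPolynomial (Fin n) k} (h : ψ a ∈ I.map ψ) :
    a ∈ I := by
  obtain ⟨c, hc, hca⟩ := (Ideal.mem_map_of_equiv ψ _).1 h
  rwa [← ψ.injective hca]

lemma map_ne_top {ψ : MvPolynomial (Fin n) k ≃ₐ[k] MvPolynomial (Fin n) k}
    {I : Ideal (MvPolynomial (Fin n) k)} (h : I ≠ ⊤) : I.map ψ ≠ ⊤ := by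
  rw [Ne, Ideal.eq_top_iff_one] at h ⊢
  rw [← map_one ψ]
  exact fun h1 => h (mem_of_map_mem h1)

/-- If `a` and `b` are linear forms, transversality makes the spaces `V` and `W` independent, so
that both become spans of variables in suitable coordinates. -/
theorem exists_monomial_lift_of_transversal {a b : MvPolynomial (Fin n) k}
    {V W : Submodule k (homogeneousSubmodule (Fin n) k 1)} (ha₁ : a.IsHomogeneous 1)
    (hb₁ : b.IsHomogeneous 1) (ha : a ≠ 0) (hb : b ≠ 0) (hV : V ≠ ⊥) (hW : W ≠ ⊥)
    (h : Transversal (Ideal.span {a} * idealOfLinearForms V)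
      (Ideal.span {b} * idealOfLinearForms W))
    (htop : Ideal.span {a} * idealOfLinearForms V ⊔ Ideal.span {b} * idealOfLinearForms W ≠ ⊤) :
    ∃ (m : ℕ) (J : Ideal (MvPolynomial (Fin m) k)), GeneratedByQuadraticMonomials J ∧
      IsQuotientByRegularLinearForms J
        (Ideal.span {a} * idealOfLinearForms V ⊔ Ideal.span {b} * idealOfLinearForms W) := by
  obtain ⟨ψ, σ, τ, hψ, hψ', hVσ, hWτ⟩ := exists_linearCoordinateChange (h.disjoint ha hb)
  have hmap : (Ideal.span {a} * idealOfLinearForms V ⊔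
      Ideal.span {b} * idealOfLinearForms W).map ψ =
      Ideal.span {ψ a} * Ideal.span (X '' σ) ⊔ Ideal.span {ψ b} * Ideal.span (X '' τ) := by
    rw [Ideal.map_sup, Ideal.map_mul, Ideal.map_mul, hVσ, hWτ, Ideal.map_span, Ideal.map_span,
      Set.image_singleton, Set.image_singleton]
  have hψb : (ψ b).IsHomogeneous 1 := isHomogeneous_algHom (φ := (ψ : _ →ₐ[k] _)) hψ hb₁
  obtain ⟨m, J, hJ, hJI⟩ := exists_monomial_lift (σ := σ) (τ := τ)
    (isHomogeneous_algHom (φ := (ψ : _ →ₐ[k] _)) hψ ha₁) hψb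
    (prime_of_isHomogeneous_one hψb (by simpa using hb))
    (fun h' => h.notMem_of_ne_bot ha hb hV (mem_of_map_mem (hWτ ▸ h')))
    (fun h' => h.symm.notMem_of_ne_bot hb ha hW (mem_of_map_mem (hVσ ▸ h')))
    (fun h' => h.not_dvd hb₁ ha hV hW (dvd_of_map_dvd h')) (hmap ▸ map_ne_top htop)
  exact ⟨m, J, hJ, IsQuotientByRegularLinearForms.of_map ψ hψ' (hmap ▸ hJI)⟩

/-- Here transversality enters only through `q ∉ M`, where `M` is the ideal generated by `W`. -/
theorem isLGQuadratic_of_irreducible_of_linear {q b : MvPolynomial (Fin n) k}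
    {W : Submodule k (homogeneousSubmodule (Fin n) k 1)} (hq₂ : q.IsHomogeneous 2)
    (hq : Irreducible q) (hb₁ : b.IsHomogeneous 1) (hb : b ≠ 0)
    (h : Transversal (Ideal.span {q}) (Ideal.span {b} * idealOfLinearForms W))
    (htop : Ideal.span {q} ⊔ Ideal.span {b} * idealOfLinearForms W ≠ ⊤) :
    IsLGQuadratic (Ideal.span {q} ⊔ Ideal.span {b} * idealOfLinearForms W) := by
  have hqW : q ∉ idealOfLinearForms W := by
    intro hqW
    -- Write `(q)` as `(q) · ⊤`; then `b * q` lies in both ideals, which gives `1 ∈ ⊤ * M`.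
    rw [← mul_one (Ideal.span {q}), Ideal.one_eq_top] at h
    have h1 := h.mem_mul hq.ne_zero hb (x := 1) trivial (by simpa using hqW)
    rw [Ideal.top_mul] at h1
    exact idealOfVars_ne_top ((Ideal.eq_top_iff_one _).2 (idealOfLinearForms_le W h1))
  have hqb : ¬ q ∣ b := fun hqb => hb (eq_zero_of_mem_idealOfVars_pow hb₁ one_lt_two
    (Ideal.mem_of_dvd _ hqb (mem_idealOfVars_pow hq₂ le_rfl)))
  obtain ⟨ψ, -, τ, hψ, hψ', -, hWτ⟩ := exists_linearCoordinateChange (disjoint_bot_left (a := W))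
  have hmap : (Ideal.span {q} ⊔ Ideal.span {b} * idealOfLinearForms W).map ψ =
      Ideal.span {ψ q} ⊔ Ideal.span {ψ b} * Ideal.span (X '' τ) := by
    rw [Ideal.map_sup, Ideal.map_mul, hWτ, Ideal.map_span, Ideal.map_span,
      Set.image_singleton, Set.image_singleton]
  have hψq : Prime (ψ q) := (MulEquiv.prime_iff ψ.toMulEquiv).2 hq.prime
  have htop' := map_ne_top (ψ := ψ) htop
  refine IsLGQuadratic.of_map ψ hψ' ?_
  rw [hmap] at htop' ⊢
  refine isLGQuadratic_quadric_sup_linear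
    (isHomogeneous_algHom (φ := (ψ : _ →ₐ[k] _)) hψ hq₂)
    (isHomogeneous_algHom (φ := (ψ : _ →ₐ[k] _)) hψ hb₁) hψq.ne_zero ?_ ?_ htop'
  · rw [← hWτ]
    exact fun h' => hqW (mem_of_map_mem h')
  · exact NonzerodivisorMod.of_isPrime ((Ideal.span_singleton_prime hψq.ne_zero).2 hψq)
      fun h' => hqb (dvd_of_map_dvd (Ideal.mem_span_singleton.1 h'))

theorem isLGQuadratic_of_irreducible_of_irreducible {q₁ q₂ : MvPolynomial (Fin n) k}
    (hq₁ : q₁.IsHomogeneous 2) (hq₂ : q₂.IsHomogeneous 2) (hirr₁ : Irreducible q₁)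
    (hirr₂ : Irreducible q₂) (h : Transversal (Ideal.span {q₁}) (Ideal.span {q₂}))
    (htop : Ideal.span {q₁} ⊔ Ideal.span {q₂} ≠ ⊤) :
    IsLGQuadratic (Ideal.span {q₁} ⊔ Ideal.span {q₂}) := by
  refine isLGQuadratic_quadric_sup_quadric hq₁ hq₂ hirr₁.ne_zero ?_ htop
  refine NonzerodivisorMod.of_isPrime
    ((Ideal.span_singleton_prime hirr₁.ne_zero).2 hirr₁.prime) fun h' => ?_
  -- If `q₁ ∣ q₂`, then `q₂` lies in the intersection, hence in `(q₁q₂)`, and `q₁` is a unit.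
  have hmem : q₂ ∈ Ideal.span {q₁} ⊓ Ideal.span {q₂} :=
    ⟨h', Ideal.mem_span_singleton_self _⟩
  rw [h, Ideal.span_singleton_mul_span_singleton, Ideal.mem_span_singleton] at hmem
  obtain ⟨c, hc⟩ := hmem
  refine hirr₁.not_isUnit (IsUnit.of_mul_eq_one c ?_)
  apply mul_left_cancel₀ hirr₂.ne_zero
  rw [mul_one]
  linear_combination -hc

end LGQuadratic

theorem proposition2p4 {k : Type*} [Field k] [IsAlgClosed k] {n : ℕ}
    (I I₁ I₂ : Ideal (MvPolynomial (Fin n) k))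
    (hI : I = I₁ ⊔ I₂)
    (hquad₁ : LGQuadratic.GeneratedByQuadrics I₁)
    (hquad₂ : LGQuadratic.GeneratedByQuadrics I₂)
    (hht₁ : I₁.height = 1) (hht₂ : I₂.height = 1)
    (htrans : LGQuadratic.Transversal I₁ I₂) :
    LGQuadratic.IsLGQuadratic I ∧
    ((∀ q : MvPolynomial (Fin n) k, Irreducible q → I₁ ≠ Ideal.span {q}) →
      (∀ q : MvPolynomial (Fin n) k, Irreducible q → I₂ ≠ Ideal.span {q}) →
      ∃ (m : ℕ) (J : Ideal (MvPolynomial (Fin m) k)),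
        LGQuadratic.GeneratedByQuadraticMonomials J ∧
        LGQuadratic.IsGQuadratic J ∧
        LGQuadratic.IsQuotientByRegularLinearForms J I) := by
  have htop : I₁ ⊔ I₂ ≠ ⊤ := fun h => LGQuadratic.idealOfVars_ne_top
    (top_le_iff.1 (h ▸ sup_le hquad₁.le_idealOfVars hquad₂.le_idealOfVars))
  subst hI
  rcases hquad₁.eq_span_or_eq_mul hht₁ with
    ⟨q₁, hq₁, hirr₁, rfl⟩ | ⟨a, V, ha₁, ha, hV, rfl⟩ <;>
  rcases hquad₂.eq_span_or_eq_mul hht₂ with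
    ⟨q₂, hq₂, hirr₂, rfl⟩ | ⟨b, W, hb₁, hb, hW, rfl⟩
  · exact ⟨LGQuadratic.isLGQuadratic_of_irreducible_of_irreducible hq₁ hq₂ hirr₁ hirr₂ htrans htop,
      fun h => absurd rfl (h q₁ hirr₁)⟩
  · exact ⟨LGQuadratic.isLGQuadratic_of_irreducible_of_linear hq₁ hirr₁ hb₁ hb htrans htop,
      fun h => absurd rfl (h q₁ hirr₁)⟩
  · rw [sup_comm] at htop ⊢
    exact ⟨LGQuadratic.isLGQuadratic_of_irreducible_of_linear hq₂ hirr₂ ha₁ ha htrans.symm htop,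
      fun _ h => absurd rfl (h q₂ hirr₂)⟩
  · obtain ⟨m, J, hJ, hJI⟩ := LGQuadratic.exists_monomial_lift_of_transversal
      ha₁ hb₁ ha hb hV hW htrans htop
    exact ⟨⟨m, J, hJ.isGQuadratic, hJI⟩, fun _ _ => ⟨m, J, hJ, hJ.isGQuadratic, hJI⟩⟩
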